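/- Let $d\ge 1$ be an integer, $\alpha\in(0,2)$ and $t>0$. Let $p_s$, $s>0$, be the transition density of the rotationally symmetric $\alpha$-stable process on $\mathbb R^d$ generated by $-(-\Delta)^{\alpha/2}$, that is, $$p_s(y)=\frac1{(2\pi)^{d}}\int_{\mathbb R^d}e^{-i\langle y,\xi\rangle}e^{-s|\xi|^\alpha}\,d\xi ,$$ let $g:[0,\infty)\to(0,\infty)$ be the strictly decreasing function with $p_s(y)=s^{-d/\alpha}g(|y|/s^{1/\alpha})$, let $g^{-1}$ be its inverse, and let $\omega_d$ be the volume of the unit ball of $\mathbb R^d$. Let $\lambda$ be a nontrivial measure on $(0,\infty)$ with $\int_{(0,\infty)}(1\wedge z^2)\,\lambda(dz)<\infty$, put $\overline\lambda(r)=\lambda((r,\infty))$, and let $$\overline\eta(r)=\eta((r,\infty)),\qquad \eta(B)=(ds\otimes dy\otimes\lambda(dz))\big(\{(s,y,z)\in(0,t]\times\mathbb R^d\times(0,\infty):\ p_s(y)z\in B\}\big).$$ Here $f\sim h$ means $\lim_{r\to\infty}f(r)/h(r)=1$; $f\asymp h$ for $r\ge1$ (resp. as $r\to\infty$) means that there is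 a constant $c\ge1$ with $c^{-1}f\le h\le cf$ for all $r\ge 1$ (resp. for all sufficiently large $r$). A measurable function $l:[1,\infty)\to(0,\infty)$ is slowly varying at infinity if $l(cr)/l(r)\to1$ as $r\to\infty$ for every $c>0$. Suppose that $$\int_{(0,1]}z^{1+\alpha/d}\,\lambda(dz)<\infty\qquad\text{and}\qquad\int_{(1,\infty)}z^{d/(d+\alpha)}\,\lambda(dz)<\infty .$$ Then the following statements hold. (i) If $\int_{(1,\infty)}z^{1+\alpha/d}\,\lambda(dz)<\infty$, then as $r\to\infty$, $$\overline\eta(r)\sim\frac{\alpha\,\omega_d}{d}\,\frac1{r^{1+\alpha/d}}\int_0^\infty u^{\alpha/d}\left(\int_{(u/g(0),\infty)}g^{-1}\!\left(\frac uz\right)^{d}\lambda(dz)\right)du .$$ (ii) Assume that $\overline\lambda(r)\asymp l(r)\,r^{-\beta}$ for $r\ge1$, for some $\beta\in[d/(d+\alpha),\,1+\alpha/d]$ and some function $l$ slowly varying at infinity. (ii-a) If $d/(d+\alpha)<\beta<1+\alpha/d$, then $\overline\eta(r)\asymp\overline\lambda(r)$ as $r\to\infty$. (ii-b) If $\beta=d/(d+\alpha)$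 and $\int_1^\infty l(u)/u\,du<\infty$, then as $r\to\infty$, $$\overline\eta(r)\asymp\frac1{r^{d/(d+\alpha)}}\int_r^\infty\frac{l(u)}u\,du .$$ (ii-c) If $\beta=1+\alpha/d$, then as $r\to\infty$, $$\overline\eta(r)\asymp\frac1{r^{1+\alpha/d}}\int_1^r\frac{l(u)}u\,du .$$ -/

import Mathlib

open MeasureTheory Filter Topology Set
open scoped ENNReal NNReal

noncomputable section

/-- The transition density `p_t(x, y) = stableDensity d α t (x - y)` of the rotationally symmetric
`α`-stable process on `ℝ^d` generated by `-(-Δ)^{α/2}`, i.e. the continuous density of the law with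
characteristic function `ξ ↦ exp (-t |ξ|^α)`, given by Fourier inversion
`p_t(x) = (2π)^{-d} ∫ exp (-i⟨x, ξ⟩) exp (-t |ξ|^α) dξ`
(the imaginary part of the integral vanishes because `ξ ↦ |ξ|` is even). -/
def stableDensity (d : ℕ) (α t : ℝ) (x : EuclideanSpace ℝ (Fin d)) : ℝ :=
  ((2 * Real.pi) ^ d)⁻¹ *
    ∫ ξ : EuclideanSpace ℝ (Fin d), Real.cos (inner ℝ x ξ) * Real.exp (-t * ‖ξ‖ ^ α)

/-- The radial profile `g` of the stable density, `p_t(x, y) = t^{-d/α} g(|x - y| / t^{1/α})`: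
the value of `p_1` at a point at distance `r` from the origin. -/
def stableProfile (d : ℕ) [NeZero d] (α r : ℝ) : ℝ :=
  stableDensity d α 1 (EuclideanSpace.single (0 : Fin d) r)

/-- The inverse function `g⁻¹` of `g : [0, ∞) → (0, g 0]`. -/
def stableProfileInv (d : ℕ) [NeZero d] (α : ℝ) : ℝ → ℝ :=
  Function.invFunOn (stableProfile d α) (Ici 0)

/-- The intensity measure `ν(ds dy dz) = ds ⊗ dy ⊗ λ(dz)` on `(0, ∞) × ℝ^d × (0, ∞)`, for a
measure `lam` on `ℝ` that is carried by `(0, ∞)`. -/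
def noiseIntensity (d : ℕ) (lam : Measure ℝ) : Measure (ℝ × EuclideanSpace ℝ (Fin d) × ℝ) :=
  (volume.restrict (Ioi (0 : ℝ))).prod
    ((volume : Measure (EuclideanSpace ℝ (Fin d))).prod (lam.restrict (Ioi (0 : ℝ))))

/-- `η(B) = ν({(s, y, z) ∈ (0, t] × ℝ^d × (0, ∞) : p_s(y) z ∈ B})`. -/
def etaMeasure (d : ℕ) (α t : ℝ) (lam : Measure ℝ) (B : Set ℝ) : ℝ≥0∞ :=
  noiseIntensity d lam
    {q | q.1 ∈ Ioc 0 t ∧ q.2.2 ∈ Ioi (0 : ℝ) ∧ stableDensity d α q.1 q.2.1 * q.2.2 ∈ B}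

/-- The tail `r ↦ η((r, ∞))`. -/
def etaTail (d : ℕ) (α t : ℝ) (lam : Measure ℝ) (r : ℝ) : ℝ≥0∞ :=
  etaMeasure d α t lam (Ioi r)

/-- The tail `r ↦ λ((r, ∞))`. -/
def lamTail (lam : Measure ℝ) (r : ℝ) : ℝ≥0∞ := lam (Ioi r)

/-- A (nontrivial) measure on `(0, ∞)` with `∫ (1 ∧ z²) λ(dz) < ∞`. -/
structure IsLevyMeasureOnPos (lam : Measure ℝ) : Prop where
  carried : lam (Iic 0) = 0
  nontrivial : lam ≠ 0
  integral_lt_top : ∫⁻ z in Ioi (0 : ℝ), ENNReal.ofReal (min 1 (z ^ 2)) ∂lam < ∞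

/-- Slow variation at infinity of a positive measurable function on `[1, ∞)`. -/
structure IsSlowlyVarying (l : ℝ → ℝ) : Prop where
  pos : ∀ r, 1 ≤ r → 0 < l r
  measurable : Measurable (fun r : Ici (1 : ℝ) => l r)
  tendsto : ∀ c : ℝ, 0 < c → Tendsto (fun r => l (c * r) / l r) atTop (𝓝 1)

/-- `f ≍ h` along a filter: there is a constant `c ≥ 1` such that `c⁻¹ f ≤ h ≤ c f`
(on a set `s` for the filter `𝓟 s`, for all large `r` for the filter `atTop`). -/
def Comparable (L : Filter ℝ) (f h : ℝ → ℝ≥0∞) : Prop :=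
  ∃ c : ℝ≥0, 1 ≤ c ∧ ∀ᶠ r in L, (c : ℝ≥0∞)⁻¹ * f r ≤ h r ∧ h r ≤ c * f r

/-- `f ∼ h` at infinity: `lim_{r → ∞} f(r) / h(r) = 1`. In `[0, ∞]` one has
`0 / 0 = ∞ / ∞ = 0`, so this forces `f` and `h` to be positive and finite for all large `r`. -/
def AsympEquiv (f h : ℝ → ℝ≥0∞) : Prop :=
  Tendsto (fun r => f r / h r) atTop (𝓝 1)

end

/-! Write `p = 1 + α/d`, `q = d/(d+α)`, and let `L(v)` be the volume of `{p_1 > v}` (`levelVolume`).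
By scaling, `{p_s > w}` has volume `s^{d/α} L(s^{d/α} w)`. Integrating over `y`, then over `s` with
`v = s^{d/α} r/z`, gives (`etaTail_eq_mul`) `η̄(r) = (α/d) r^{-p} ∫ z^p K(t^{d/α} r/z) λ(dz)`, where
`K(x) = ∫_0^x v^{α/d} L(v) dv` (`truncatedMoment`). Everything follows from the behaviour of `K`: it
is constant beyond `g(0)`, and it is comparable to `x^{p-q}` near `0`, because `g(r) ≍ r^{-(d+α)}`
for large `r` forces `L(v) ≍ v^{-q}` for small `v`.

For (i), dominated convergence gives `r^p η̄(r) → (α/d) K(g(0)) ∫ z^p dλ`, and Tonelli turns this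
limit into the stated double integral (`lintegral_stableProfileInv_eq`).

For (ii), splitting at `z = r` gives `η̄(r) ≍ r^{-p} ∫_{(0,r]} z^p dλ + r^{-q} ∫_{(r,∞)} z^q dλ`
(`etaTail_le`, `le_etaTail`). By the layer-cake formula this is comparable to the sum of `λ̄(r)` and
the means `r^{-p} ∫_0^r u^{p-1} λ̄(u) du` and `r^{-q} ∫_r^∞ u^{q-1} λ̄(u) du`. Karamata-type
estimates, resting on Potter's bounds, decide which term dominates: `λ̄` controls both means if `q <
β < p`, the upper mean wins if `β = q`, and the lower mean wins if `β = p`.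

The facts about `g` come from subordination. The `α/2`-stable subordinator is built as a limit of
sums of Pareto variables, so `p_1` is a mixture of Gaussian densities. Monotonicity and continuity
of `g` follow at once; its tail bounds follow by comparing the Gaussian kernel, as a function of
time, with combinations of exponentials whose integrals are known from the Laplace transform. -/

noncomputable section

/-! ### Construction of the stable subordinator -/

/-- `f` is, on `(0, ∞)`, the function `x ↦ ∫ v ^ x ∂μ` of a probability measure on `[0, 1]`. -/
def IsMomentFunction (f : ℝ → ℝ) : Prop :=
  ∃ μ : ProbabilityMeasure unitInterval, ∀ x, 0 < x → ∫ v, (v : ℝ) ^ x ∂(μ : Measure unitInterval) = f x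

lemma IsMomentFunction.one : IsMomentFunction (fun _ => 1) :=
  ⟨⟨Measure.dirac 1, inferInstance⟩, fun x _ => by simp⟩

/-- Moments of a product of independent variables multiply. With `v = e^{-u}` this is the Laplace
transform of a convolution. -/
lemma IsMomentFunction.mul {f g : ℝ → ℝ} (hf : IsMomentFunction f) (hg : IsMomentFunction g) :
    IsMomentFunction (fun x => f x * g x) := by
  obtain ⟨μ, hμ⟩ := hf
  obtain ⟨ν, hν⟩ := hg
  have hm : Measurable (fun p : unitInterval × unitInterval => p.1 * p.2) :=
    continuous_mul.measurable
  refine ⟨⟨((μ : Measure unitInterval).prod (ν : Measure unitInterval)).map (fun p => p.1 * p.2),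
    Measure.isProbabilityMeasure_map hm.aemeasurable⟩, fun x hx => ?_⟩
  have hms : Measurable (fun v : unitInterval => (v : ℝ) ^ x) :=
    measurable_subtype_coe.pow_const x
  dsimp only
  rw [ProbabilityMeasure.coe_mk, integral_map hm.aemeasurable hms.aestronglyMeasurable, ← hμ x hx,
    ← hν x hx, ← integral_prod_mul]
  refine integral_congr_ae (.of_forall fun p => ?_)
  exact Real.mul_rpow p.1.2.1 p.2.2.1

lemma IsMomentFunction.pow {f : ℝ → ℝ} (hf : IsMomentFunction f) (n : ℕ) :
    IsMomentFunction (fun x => f x ^ n) := by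
  induction n with
  | zero => simpa using IsMomentFunction.one
  | succ n ih => simpa only [pow_succ] using ih.mul hf

/-- Probability measures on a compact interval form a weakly compact space, so no tightness is
needed: mass escaping to `u = ∞` is kept at `v = 0`. The function `v ^ x` is continuous there
because `x > 0`. -/
lemma IsMomentFunction.of_tendsto {F : ℕ → ℝ → ℝ} {f : ℝ → ℝ} (hF : ∀ n, IsMomentFunction (F n))
    (hf : ∀ x, 0 < x → Tendsto (fun n => F n x) atTop (𝓝 (f x))) : IsMomentFunction f := by
  choose μ hμ using hF
  -- A limit along an ultrafilter replaces the extraction of a convergent subsequence.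
  have hlim := ((hyperfilter ℕ).map μ).le_nhds_lim
  set ν := ((hyperfilter ℕ).map μ).lim
  have ht : Tendsto μ (hyperfilter ℕ) (𝓝 ν) := hlim
  refine ⟨ν, fun x hx => ?_⟩
  rw [ProbabilityMeasure.tendsto_iff_forall_integral_tendsto] at ht
  have hc : Continuous (fun v : unitInterval => (v : ℝ) ^ x) :=
    continuous_subtype_val.rpow_const fun _ => Or.inr hx.le
  have h1 := ht (BoundedContinuousFunction.mkOfCompact ⟨_, hc⟩)
  simp only [BoundedContinuousFunction.mkOfCompact_apply, ContinuousMap.coe_mk, hμ _ x hx] at h1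
  exact tendsto_nhds_unique h1 ((hf x hx).mono_left (Nat.hyperfilter_le_atTop))

lemma integral_pareto {a δ : ℝ} (ha : 0 < a) (hδ : 0 < δ) :
    ∫ u in Ioi δ, a * δ ^ a * u ^ (-1 - a) = 1 := by
  rw [integral_const_mul, integral_Ioi_rpow_of_lt (by linarith) hδ]
  have h1 : -1 - a + 1 = -a := by ring
  rw [h1, Real.rpow_neg hδ.le]
  have := (Real.rpow_pos_of_pos hδ a).ne'
  field_simp

/-- This is the Laplace transform of the Pareto law with density `a δ^a u^{-1-a}` on `(δ, ∞)`,
carried to `[0, 1]` by `u ↦ e^{-u}`. The form `1 - …` exhibits the Lévy integral of the stable law,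
cut off at `δ`. -/
lemma isMomentFunction_pareto {a δ : ℝ} (ha : 0 < a) (hδ : 0 < δ) :
    IsMomentFunction
      (fun x => 1 - a * δ ^ a * ∫ u in Ioi δ, (1 - Real.exp (-(x * u))) * u ^ (-1 - a)) := by
  set ρ : ℝ → ℝ := fun u => a * δ ^ a * u ^ (-1 - a) with hρ
  have hρ0 : ∀ u ∈ Ioi δ, 0 ≤ ρ u := fun u hu => by
    have : 0 < u := hδ.trans hu
    positivity
  have hint : IntegrableOn ρ (Ioi δ) :=
    (integrableOn_Ioi_rpow_of_lt (by linarith) hδ).const_mul _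
  have hρm : Measurable ρ := by fun_prop
  set μ₀ : Measure ℝ := (volume.restrict (Ioi δ)).withDensity (fun u => ENNReal.ofReal (ρ u))
    with hμ₀
  have hprob : IsProbabilityMeasure μ₀ := by
    constructor
    rw [hμ₀, withDensity_apply _ MeasurableSet.univ, Measure.restrict_univ,
      ← ofReal_integral_eq_lintegral_ofReal hint
        ((ae_restrict_iff' measurableSet_Ioi).2 (.of_forall hρ0)), integral_pareto ha hδ]
    simp
  have hem : Measurable (fun u : ℝ => projIcc (0 : ℝ) 1 zero_le_one (Real.exp (-u))) :=
    (continuous_projIcc.comp (by fun_prop)).measurable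
  refine ⟨⟨μ₀.map (fun u => projIcc (0 : ℝ) 1 zero_le_one (Real.exp (-u))),
    Measure.isProbabilityMeasure_map hem.aemeasurable⟩, fun x hx => ?_⟩
  have hms : Measurable (fun v : unitInterval => (v : ℝ) ^ x) :=
    measurable_subtype_coe.pow_const x
  dsimp only
  rw [ProbabilityMeasure.coe_mk, integral_map hem.aemeasurable hms.aestronglyMeasurable, hμ₀,
    integral_withDensity_eq_integral_toReal_smul (by fun_prop) (by simp)]
  have hexp : IntegrableOn (fun u => ρ u * Real.exp (-(x * u))) (Ioi δ) := by
    refine hint.mul_bdd (c := 1) (by fun_prop) ?_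
    filter_upwards [ae_restrict_mem measurableSet_Ioi] with u hu
    have : 0 < u := hδ.trans hu
    rw [Real.norm_eq_abs, abs_of_pos (Real.exp_pos _), Real.exp_le_one_iff]
    nlinarith
  rw [← integral_const_mul]
  nth_rewrite 2 [← integral_pareto ha hδ]
  have h2 : ∀ u : ℝ, a * δ ^ a * ((1 - Real.exp (-(x * u))) * u ^ (-1 - a)) =
      ρ u - ρ u * Real.exp (-(x * u)) := fun u => by simp only [hρ]; ring
  simp_rw [h2]
  rw [integral_sub hint hexp, sub_sub_cancel]
  refine setIntegral_congr_fun measurableSet_Ioi fun u hu => ?_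
  have hu0 : 0 < u := hδ.trans hu
  have hmem : Real.exp (-u) ∈ Icc (0 : ℝ) 1 :=
    ⟨(Real.exp_pos _).le, Real.exp_le_one_iff.2 (by linarith)⟩
  simp only [projIcc_of_mem zero_le_one hmem, smul_eq_mul, ENNReal.toReal_ofReal (hρ0 u hu)]
  rw [← Real.exp_mul]
  ring_nf

lemma integrableOn_one_sub_exp_mul_rpow {a : ℝ} (ha : 0 < a) (ha1 : a < 1) :
    IntegrableOn (fun u : ℝ => (1 - Real.exp (-u)) * u ^ (-1 - a)) (Ioi 0) := by
  rw [← Ioc_union_Ioi_eq_Ioi zero_le_one]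
  have hm : Measurable (fun u : ℝ => (1 - Real.exp (-u)) * u ^ (-1 - a)) := by fun_prop
  refine IntegrableOn.union ?_ ?_
  · have h1 : IntegrableOn (fun u : ℝ => u ^ (-a)) (Ioc 0 1) :=
      (intervalIntegrable_iff_integrableOn_Ioc_of_le zero_le_one).1
        (intervalIntegral.intervalIntegrable_rpow' (by linarith))
    refine h1.mono' hm.aestronglyMeasurable ?_
    filter_upwards [ae_restrict_mem measurableSet_Ioc] with u hu
    have h2 : 0 ≤ 1 - Real.exp (-u) := by
      have := Real.exp_le_one_iff.2 (neg_nonpos.2 hu.1.le); linarith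
    have h3 : 1 - Real.exp (-u) ≤ u := by have := Real.add_one_le_exp (-u); linarith
    have h4 : 0 ≤ u ^ (-1 - a) := Real.rpow_nonneg hu.1.le _
    rw [Real.norm_eq_abs, abs_of_nonneg (mul_nonneg h2 h4)]
    calc _ ≤ u * u ^ (-1 - a) := by gcongr
      _ = u ^ (-a) := by
        nth_rewrite 1 [← Real.rpow_one u]
        rw [← Real.rpow_add hu.1]; ring_nf
  · refine (integrableOn_Ioi_rpow_of_lt (a := -1 - a) (by linarith) one_pos).mono'
      hm.aestronglyMeasurable ?_
    filter_upwards [ae_restrict_mem measurableSet_Ioi] with u hu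
    have hu0 : (0 : ℝ) < u := one_pos.trans hu
    have h2 : 0 ≤ 1 - Real.exp (-u) := by
      have := Real.exp_le_one_iff.2 (neg_nonpos.2 hu0.le); linarith
    have h4 : 0 ≤ u ^ (-1 - a) := Real.rpow_nonneg hu0.le _
    rw [Real.norm_eq_abs, abs_of_nonneg (mul_nonneg h2 h4)]
    exact mul_le_of_le_one_left h4 (by have := Real.exp_pos (-u); linarith)

lemma integral_one_sub_exp_mul_rpow_pos {a : ℝ} (ha : 0 < a) (ha1 : a < 1) :
    0 < ∫ u in Ioi (0 : ℝ), (1 - Real.exp (-u)) * u ^ (-1 - a) := by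
  have hpos : ∀ u ∈ Ioi (0 : ℝ), 0 < (1 - Real.exp (-u)) * u ^ (-1 - a) := fun u hu =>
    mul_pos (sub_pos.2 (Real.exp_lt_one_iff.2 (neg_lt_zero.2 hu)))
      (Real.rpow_pos_of_pos hu _)
  rw [setIntegral_pos_iff_support_of_nonneg_ae
    ((ae_restrict_iff' measurableSet_Ioi).2 (.of_forall fun u hu => (hpos u hu).le))
    (integrableOn_one_sub_exp_mul_rpow ha ha1)]
  have hsub : Ioi (0 : ℝ) ⊆ Function.support fun u : ℝ => (1 - Real.exp (-u)) * u ^ (-1 - a) :=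
    fun u hu => (hpos u hu).ne'
  rw [inter_eq_self_of_subset_right hsub]
  simp

lemma one_sub_exp_mul_rpow_scale {a x : ℝ} (hx : 0 < x) {u : ℝ} (hu : 0 < u) :
    (1 - Real.exp (-(x * u))) * u ^ (-1 - a) =
      x ^ (1 + a) * ((1 - Real.exp (-(x * u))) * (x * u) ^ (-1 - a)) := by
  rw [Real.mul_rpow hx.le hu.le]
  have : x ^ (1 + a) * x ^ (-1 - a) = 1 := by
    rw [← Real.rpow_add hx]; simp
  linear_combination (-(1 - Real.exp (-(x * u))) * u ^ (-1 - a)) * this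

lemma integrableOn_one_sub_exp_mul_rpow_scale {a x : ℝ} (ha : 0 < a) (ha1 : a < 1) (hx : 0 < x) :
    IntegrableOn (fun u : ℝ => (1 - Real.exp (-(x * u))) * u ^ (-1 - a)) (Ioi 0) := by
  have h := (integrableOn_Ioi_comp_mul_left_iff
    (fun u : ℝ => (1 - Real.exp (-u)) * u ^ (-1 - a)) 0 hx).2
      (by simpa using integrableOn_one_sub_exp_mul_rpow ha ha1)
  exact IntegrableOn.congr_fun (h.const_mul (x ^ (1 + a)))
    (fun u hu => (one_sub_exp_mul_rpow_scale hx hu).symm) measurableSet_Ioi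

lemma integral_one_sub_exp_mul_rpow_scale {a x : ℝ} (hx : 0 < x) :
    ∫ u in Ioi (0 : ℝ), (1 - Real.exp (-(x * u))) * u ^ (-1 - a) =
      x ^ a * ∫ u in Ioi (0 : ℝ), (1 - Real.exp (-u)) * u ^ (-1 - a) := by
  rw [setIntegral_congr_fun measurableSet_Ioi
    (fun u hu => one_sub_exp_mul_rpow_scale (a := a) hx hu), integral_const_mul,
    integral_comp_mul_left_Ioi (fun u : ℝ => (1 - Real.exp (-u)) * u ^ (-1 - a)) 0 hx,
    mul_zero, smul_eq_mul, ← mul_assoc]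
  congr 1
  rw [Real.rpow_add hx, Real.rpow_one]
  field_simp

/-- A sum of `n + 1` independent Pareto variables has Laplace transform `(1 - J_n / ((n+1)
C))^{n+1}`, where `J_n → C x^a`, and this tends to `exp (-x^a)`. -/
lemma isMomentFunction_exp_neg_rpow {a : ℝ} (ha : 0 < a) (ha1 : a < 1) :
    IsMomentFunction (fun x => Real.exp (-x ^ a)) := by
  set C := ∫ u in Ioi (0 : ℝ), (1 - Real.exp (-u)) * u ^ (-1 - a) with hC
  have hC0 : 0 < C := integral_one_sub_exp_mul_rpow_pos ha ha1
  -- Solves `a δ^a = 1 / ((n+1) C)`.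
  set δ : ℕ → ℝ := fun n => (((n : ℝ) + 1) * (a * C)) ^ (-a⁻¹) with hδ
  have hδ0 : ∀ n, 0 < δ n := fun n => by positivity
  have hδa : ∀ n, a * δ n ^ a = (((n : ℝ) + 1) * C)⁻¹ := fun n => by
    rw [hδ, ← Real.rpow_mul (by positivity), neg_mul, inv_mul_cancel₀ ha.ne', Real.rpow_neg_one]
    field_simp
  have hδt : Tendsto δ atTop (𝓝 0) := by
    refine (tendsto_rpow_neg_atTop (inv_pos.2 ha)).comp ?_
    exact (tendsto_atTop_add_const_right _ _ tendsto_natCast_atTop_atTop).atTop_mul_const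
      (by positivity)
  refine IsMomentFunction.of_tendsto
    (fun n => (isMomentFunction_pareto ha (hδ0 n)).pow (n + 1)) fun x hx => ?_
  set J : ℕ → ℝ := fun n => ∫ u in Ioi (δ n), (1 - Real.exp (-(x * u))) * u ^ (-1 - a) with hJ
  have hJt : Tendsto J atTop (𝓝 (x ^ a * C)) := by
    have h := (aecover_Ioi_of_Ioi (μ := volume) hδt).integral_tendsto_of_countably_generated
      (integrableOn_one_sub_exp_mul_rpow_scale ha ha1 hx)
    rw [integral_one_sub_exp_mul_rpow_scale hx] at h
    refine h.congr fun n => ?_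
    rw [Measure.restrict_restrict measurableSet_Ioi,
      inter_eq_self_of_subset_left (Ioi_subset_Ioi (hδ0 n).le)]
  -- The index is shifted so that `g (n + 1)` goes with the power `n + 1`; the value at `0` plays no
  -- role.
  set g : ℕ → ℝ := fun n => -((n : ℝ) * C)⁻¹ * J (n - 1) with hg
  have hgt : Tendsto (fun n : ℕ => (n : ℝ) * g n) atTop (𝓝 (-x ^ a)) := by
    have h1 : Tendsto (fun n => -(C⁻¹ * J (n - 1))) atTop (𝓝 (-(C⁻¹ * (x ^ a * C)))) :=
      ((hJt.comp (tendsto_sub_atTop_nat 1)).const_mul _).neg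
    have h2 : C⁻¹ * (x ^ a * C) = x ^ a := by field_simp
    rw [h2] at h1
    refine h1.congr' ?_
    filter_upwards [eventually_ge_atTop 1] with n hn
    have : (n : ℝ) ≠ 0 := by positivity
    simp only [hg]
    field_simp
  have := (Real.tendsto_one_add_pow_exp_of_tendsto hgt).comp (tendsto_add_atTop_nat 1)
  refine this.congr fun n => ?_
  simp only [Function.comp, hg, hδa]
  push_cast
  congr 1
  simp only [hJ]
  ring

/-- The law of the `a`-stable subordinator at time one. -/
lemma exists_stable_subordinator {a : ℝ} (ha : 0 < a) (ha1 : a < 1) :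
    ∃ μ : Measure ℝ, IsProbabilityMeasure μ ∧ (∀ᵐ u ∂μ, 0 < u) ∧
      ∀ x, 0 < x → ∫ u, Real.exp (-(x * u)) ∂μ = Real.exp (-x ^ a) := by
  obtain ⟨ν, hν⟩ := isMomentFunction_exp_neg_rpow ha ha1
  dsimp only at hν
  have hint : ∀ x : ℝ, 0 < x → Integrable (fun v : unitInterval => (v : ℝ) ^ x)
      (ν : Measure unitInterval) := fun x hx => by
    refine Integrable.of_bound
      (measurable_subtype_coe.pow_const x).aestronglyMeasurable 1 (.of_forall fun v => ?_)
    rw [Real.norm_eq_abs, abs_of_nonneg (Real.rpow_nonneg v.2.1 _)]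
    exact Real.rpow_le_one v.2.1 v.2.2 hx.le
  have hseq : Tendsto (fun n : ℕ => ((n : ℝ) + 1)) atTop atTop :=
    tendsto_atTop_add_const_right _ _ tendsto_natCast_atTop_atTop
  -- No atom at `v = 1`, that is, at `u = 0`: let `x → ∞` in the moment identity.
  have h1 : ∀ᵐ v : unitInterval ∂(ν : Measure unitInterval), (v : ℝ) ≠ 1 := by
    have hle : ∀ n : ℕ, (ν : Measure unitInterval).real {1} ≤ Real.exp (-((n : ℝ) + 1) ^ a) := by
      intro n
      rw [← hν _ (by positivity), ← integral_indicator_one (measurableSet_singleton _)]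
      refine integral_mono ((integrable_const (1 : ℝ)).indicator (measurableSet_singleton _))
        (hint _ (by positivity)) fun v => ?_
      by_cases hv : v = 1
      · simp [hv]
      · simpa [hv] using Real.rpow_nonneg v.2.1 _
    have ht : Tendsto (fun n : ℕ => Real.exp (-((n : ℝ) + 1) ^ a)) atTop (𝓝 0) :=
      Real.tendsto_exp_neg_atTop_nhds_zero.comp ((tendsto_rpow_atTop ha).comp hseq)
    have h0 : (ν : Measure unitInterval).real {1} = 0 :=
      le_antisymm (ge_of_tendsto' ht hle) measureReal_nonneg
    rw [measureReal_eq_zero_iff] at h0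
    refine (measure_eq_zero_iff_ae_notMem.1 h0).mono fun v hv h => hv ?_
    exact Subtype.ext h
  -- No atom at `v = 0`, that is, no mass lost at `u = ∞`: let `x → 0`.
  have h0 : ∀ᵐ v : unitInterval ∂(ν : Measure unitInterval), (v : ℝ) ≠ 0 := by
    have hle : ∀ n : ℕ, Real.exp (-((n : ℝ) + 1)⁻¹ ^ a) ≤
        (ν : Measure unitInterval).real {0}ᶜ := by
      intro n
      rw [← hν _ (by positivity), ← integral_indicator_one (measurableSet_singleton _).compl]
      refine integral_mono (hint _ (by positivity))
        ((integrable_const (1 : ℝ)).indicator (measurableSet_singleton _).compl) fun v => ?_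
      by_cases hv : v = 0
      · have : ((n : ℝ) + 1)⁻¹ ≠ 0 := by positivity
        simp [hv, Real.zero_rpow this]
      · simpa [hv] using Real.rpow_le_one v.2.1 v.2.2 (by positivity)
    have ht : Tendsto (fun n : ℕ => Real.exp (-((n : ℝ) + 1)⁻¹ ^ a)) atTop (𝓝 1) := by
      have h := (Real.continuous_exp.tendsto _).comp
        (((Real.continuousAt_rpow_const 0 a (Or.inr ha.le)).tendsto.comp
          (tendsto_inv_atTop_zero.comp hseq)).neg)
      simpa [Real.zero_rpow ha.ne', Function.comp_def] using h
    have h2 : (ν : Measure unitInterval).real {0}ᶜ = 1 :=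
      le_antisymm measureReal_le_one (le_of_tendsto' ht hle)
    have h3 := probReal_compl_eq_one_sub (μ := (ν : Measure unitInterval))
      (measurableSet_singleton (0 : unitInterval))
    have h4 : (ν : Measure unitInterval).real {0} = 0 := by linarith
    rw [measureReal_eq_zero_iff] at h4
    refine (measure_eq_zero_iff_ae_notMem.1 h4).mono fun v hv h => hv ?_
    exact Subtype.ext h
  have hm : Measurable (fun v : unitInterval => -Real.log v) :=
    (Real.measurable_log.comp measurable_subtype_coe).neg
  refine ⟨(ν : Measure unitInterval).map (fun v : unitInterval => -Real.log v),
    Measure.isProbabilityMeasure_map hm.aemeasurable, ?_, fun x hx => ?_⟩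
  · refine (ae_map_iff hm.aemeasurable measurableSet_Ioi).2 ?_
    filter_upwards [h0, h1] with v hv0 hv1
    exact neg_pos.2 (Real.log_neg (lt_of_le_of_ne v.2.1 (Ne.symm hv0)) (lt_of_le_of_ne v.2.2 hv1))
  · have hme : Measurable fun u : ℝ => Real.exp (-(x * u)) := by fun_prop
    rw [integral_map hm.aemeasurable hme.aestronglyMeasurable, ← hν x hx]
    refine integral_congr_ae ?_
    filter_upwards [h0] with v hv0
    rw [Real.rpow_def_of_pos (lt_of_le_of_ne v.2.1 (Ne.symm hv0))]
    ring_nf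

/-! ### Subordination -/

lemma integrable_exp_neg_norm_rpow (d : ℕ) [NeZero d] {α : ℝ} (hα : 0 < α) :
    Integrable (fun ξ : EuclideanSpace ℝ (Fin d) => Real.exp (-‖ξ‖ ^ α)) := by
  rw [integrable_fun_norm_addHaar volume (f := fun r : ℝ => Real.exp (-r ^ α))]
  have h := integral_rpow_mul_exp_neg_rpow (p := α) (q := (d - 1 : ℕ)) hα
    (lt_of_lt_of_le (by norm_num) (Nat.cast_nonneg _))
  -- A nonintegrable function has Bochner integral `0`, whereas the Gamma value is positive.
  have h2 : IntegrableOn (fun x : ℝ => x ^ ((d - 1 : ℕ) : ℝ) * Real.exp (-x ^ α)) (Ioi 0) := by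
    by_contra hn
    rw [integral_undef hn] at h
    have : 0 < (1 / α) * Real.Gamma ((((d - 1 : ℕ) : ℝ) + 1) / α) :=
      mul_pos (by positivity) (Real.Gamma_pos_of_pos (by positivity))
    linarith
  refine h2.congr_fun (fun x _ => ?_) measurableSet_Ioi
  simp

lemma integral_cos_mul_exp_neg_mul_sq (d : ℕ) {u : ℝ} (hu : 0 < u)
    (x : EuclideanSpace ℝ (Fin d)) :
    ∫ ξ : EuclideanSpace ℝ (Fin d), Real.cos (inner ℝ x ξ) * Real.exp (-(‖ξ‖ ^ 2 * u)) =
      (Real.pi / u) ^ ((d : ℝ) / 2) * Real.exp (-(‖x‖ ^ 2 / (4 * u))) := by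
  have hu' : 0 < (u : ℂ).re := by simpa using hu
  have h := GaussianFourier.integral_cexp_neg_mul_sq_norm_add hu' Complex.I x
  have hi := GaussianFourier.integrable_cexp_neg_mul_sq_norm_add hu' Complex.I x
  have hre := congrArg Complex.re h
  rw [← Complex.reCLM_apply, ← ContinuousLinearMap.integral_comp_comm _ hi] at hre
  have h1 : ∀ ξ : EuclideanSpace ℝ (Fin d),
      Complex.reCLM (Complex.exp (-(u : ℂ) * (‖ξ‖ : ℂ) ^ 2 + Complex.I * (inner ℝ x ξ : ℝ))) =
        Real.cos (inner ℝ x ξ) * Real.exp (-(‖ξ‖ ^ 2 * u)) := fun ξ => by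
    have : -(u : ℂ) * (‖ξ‖ : ℂ) ^ 2 + Complex.I * (inner ℝ x ξ : ℝ) =
        ((-(‖ξ‖ ^ 2 * u) : ℝ) : ℂ) + ((inner ℝ x ξ : ℝ) : ℂ) * Complex.I := by
      push_cast; ring
    rw [this, Complex.exp_add, Complex.exp_mul_I, ← Complex.ofReal_exp, ← Complex.ofReal_cos,
      ← Complex.ofReal_sin, Complex.reCLM_apply, Complex.re_ofReal_mul]
    simp [mul_comm]
    exact Complex.cos_ofReal_re _
  simp_rw [h1] at hre
  rw [hre]
  have h2 : ((Real.pi : ℂ) / u) ^ ((Module.finrank ℝ (EuclideanSpace ℝ (Fin d)) : ℂ) / 2) *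
      Complex.exp (Complex.I ^ 2 * (‖x‖ : ℂ) ^ 2 / (4 * u)) =
      (((Real.pi / u) ^ ((d : ℝ) / 2) * Real.exp (-(‖x‖ ^ 2 / (4 * u))) : ℝ) : ℂ) := by
    rw [Complex.ofReal_mul, Complex.ofReal_cpow (by positivity), Complex.ofReal_exp]
    congr 2
    · push_cast; rfl
    · simp
    · push_cast; rw [Complex.I_sq]; ring
  rw [h2, Complex.ofReal_re]

/-- The Gaussian mixture `r ↦ ∫ u ^ (-d/2) exp (-r² / (4u)) μ(du)`. -/
def gaussianMixture (d : ℕ) (μ : Measure ℝ) (r : ℝ) : ℝ :=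
  ∫ u, u ^ (-((d : ℝ) / 2)) * Real.exp (-(r ^ 2 / (4 * u))) ∂μ

/-- Subordination: the stable density is a mixture of Gaussian densities. -/
lemma exists_stableDensity_eq_gaussianMixture (d : ℕ) [NeZero d] {α : ℝ} (hα0 : 0 < α)
    (hα2 : α < 2) :
    ∃ μ : Measure ℝ, IsProbabilityMeasure μ ∧ (∀ᵐ u ∂μ, 0 < u) ∧
      (∀ x, 0 < x → ∫ u, Real.exp (-(x * u)) ∂μ = Real.exp (-x ^ (α / 2))) ∧
      Integrable (fun u : ℝ => u ^ (-((d : ℝ) / 2))) μ ∧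
      ∃ c : ℝ, 0 < c ∧ ∀ x, stableDensity d α 1 x = c * gaussianMixture d μ ‖x‖ := by
  obtain ⟨μ, hμ, hpos, hL⟩ := exists_stable_subordinator (a := α / 2) (by linarith) (by linarith)
  refine ⟨μ, hμ, hpos, hL, ?_⟩
  -- The Laplace transform at `‖ξ‖²` is the stable characteristic function.
  have hL' : ∀ ξ : EuclideanSpace ℝ (Fin d),
      ∫ u, Real.exp (-(‖ξ‖ ^ 2 * u)) ∂μ = Real.exp (-‖ξ‖ ^ α) := fun ξ => by
    rcases eq_or_ne ξ 0 with rfl | hξ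
    · simp [Real.zero_rpow hα0.ne']
    · have hn : 0 < ‖ξ‖ := norm_pos_iff.2 hξ
      rw [hL _ (by positivity), ← Real.rpow_natCast, ← Real.rpow_mul hn.le]
      congr 3
      push_cast; ring
  have hF0 : Integrable (fun p : EuclideanSpace ℝ (Fin d) × ℝ => Real.exp (-(‖p.1‖ ^ 2 * p.2)))
      (volume.prod μ) := by
    have hc : Continuous fun p : EuclideanSpace ℝ (Fin d) × ℝ => Real.exp (-(‖p.1‖ ^ 2 * p.2)) := by
      fun_prop
    rw [integrable_prod_iff hc.aestronglyMeasurable]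
    refine ⟨.of_forall fun ξ => ?_, ?_⟩
    · refine Integrable.of_bound (by fun_prop) 1 ?_
      filter_upwards [hpos] with u hu
      rw [Real.norm_eq_abs, abs_of_pos (Real.exp_pos _), Real.exp_le_one_iff]
      simp only [Left.neg_nonpos_iff]; positivity
    · refine (integrable_exp_neg_norm_rpow d hα0).congr (.of_forall fun ξ => ?_)
      simp only [Real.norm_eq_abs, Real.abs_exp, hL']
  have hF : ∀ x : EuclideanSpace ℝ (Fin d), Integrable
      (fun p : EuclideanSpace ℝ (Fin d) × ℝ =>
        Real.cos (inner ℝ x p.1) * Real.exp (-(‖p.1‖ ^ 2 * p.2))) (volume.prod μ) := fun x => by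
    have hc : Continuous fun p : EuclideanSpace ℝ (Fin d) × ℝ =>
        Real.cos (inner ℝ x p.1) * Real.exp (-(‖p.1‖ ^ 2 * p.2)) := by fun_prop
    refine hF0.mono hc.aestronglyMeasurable (.of_forall fun p => ?_)
    rw [norm_mul]
    exact mul_le_of_le_one_left (norm_nonneg _) (Real.abs_cos_le_one _)
  have hsplit : ∀ u : ℝ, 0 < u →
      (Real.pi / u) ^ ((d : ℝ) / 2) = Real.pi ^ ((d : ℝ) / 2) * u ^ (-((d : ℝ) / 2)) :=
    fun u hu => by
      rw [Real.div_rpow Real.pi_pos.le hu.le, Real.rpow_neg hu.le, div_eq_mul_inv]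
  refine ⟨?_, ((2 * Real.pi) ^ d)⁻¹ * Real.pi ^ ((d : ℝ) / 2), by positivity, fun x => ?_⟩
  -- Fubini at `x = 0`: the inner Gaussian integral is a multiple of `u^{-d/2}`.
  · have h := (hF 0).integral_prod_right
    have h2 := h.const_mul (Real.pi ^ ((d : ℝ) / 2))⁻¹
    refine h2.congr ?_
    filter_upwards [hpos] with u hu
    rw [integral_cos_mul_exp_neg_mul_sq d hu, hsplit u hu]
    have : Real.pi ^ ((d : ℝ) / 2) ≠ 0 := by positivity
    simp
    field_simp
  · rw [stableDensity, mul_assoc]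
    congr 1
    rw [gaussianMixture, ← integral_const_mul]
    have h1 : ∀ ξ : EuclideanSpace ℝ (Fin d),
        Real.cos (inner ℝ x ξ) * Real.exp (-1 * ‖ξ‖ ^ α) =
          ∫ u, Real.cos (inner ℝ x ξ) * Real.exp (-(‖ξ‖ ^ 2 * u)) ∂μ := fun ξ => by
      rw [integral_const_mul, hL', neg_one_mul]
    simp_rw [h1]
    rw [integral_integral_swap (f := fun (ξ : EuclideanSpace ℝ (Fin d)) (u : ℝ) =>
      Real.cos (inner ℝ x ξ) * Real.exp (-(‖ξ‖ ^ 2 * u))) (hF x)]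
    refine integral_congr_ae ?_
    filter_upwards [hpos] with u hu
    rw [integral_cos_mul_exp_neg_mul_sq d hu, hsplit u hu, mul_assoc]

/-! ### Comparison of the Gaussian kernel with exponentials in time -/

section Elementary

lemma exp_neg_sub_exp_neg_le {x y : ℝ} (hx : 0 ≤ x) (hxy : x ≤ y) :
    Real.exp (-x) - Real.exp (-y) ≤ y - x := by
  have h1 : Real.exp (-y) = Real.exp (-x) * Real.exp (-(y - x)) := by
    rw [← Real.exp_add]; ring_nf
  have h2 := Real.add_one_le_exp (-(y - x))
  have h3 : Real.exp (-x) ≤ 1 := Real.exp_le_one_iff.2 (by linarith)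
  have h4 := Real.exp_pos (-x)
  have h5 : Real.exp (-x) * (1 - (y - x)) ≤ Real.exp (-y) := by
    rw [h1]; gcongr; linarith
  nlinarith

lemma le_exp_neg_sub_exp_neg (x y : ℝ) :
    (y - x) * Real.exp (-y) ≤ Real.exp (-x) - Real.exp (-y) := by
  have h1 : Real.exp (-x) = Real.exp (-y) * Real.exp (y - x) := by
    rw [← Real.exp_add]; ring_nf
  have h2 := Real.add_one_le_exp (y - x)
  have h4 := Real.exp_pos (-y)
  rw [h1]
  nlinarith

/-- The profile of the Gaussian kernel as a function of time. -/
def gaussianTime (d : ℕ) (v : ℝ) : ℝ := v ^ (-((d : ℝ) / 2)) * Real.exp (-(1 / (4 * v)))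

/-- The factor `e^{-1/(4v)}` beats every power of `1/v` near `0`, and `1 - e^{-v}` is bounded below
away from `0`. The right side integrates explicitly against the subordinator law. -/
lemma gaussianTime_le (d : ℕ) : ∃ C : ℝ, 0 < C ∧ ∀ v, 0 < v →
    gaussianTime d v ≤ C * (1 - Real.exp (-v)) := by
  -- The constant comes from `x^n / n! ≤ e^x` with `n = d + 1` and `x = (1 + 1/v) / 4`.
  refine ⟨4 ^ (d + 1) * (d + 1).factorial * Real.exp (1 / 4), by positivity, fun v hv => ?_⟩
  set w := v⁻¹ with hw
  have hw0 : 0 < w := inv_pos.2 hv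
  have h1 : (1 + w)⁻¹ ≤ 1 - Real.exp (-v) := by
    have h2 := Real.add_one_le_exp v
    have h3 : Real.exp (-v) ≤ (v + 1)⁻¹ := by
      rw [Real.exp_neg]; gcongr
    have h4 : (1 + w)⁻¹ = 1 - (v + 1)⁻¹ := by rw [hw]; field_simp; ring
    linarith
  have h5 : v ^ (-((d : ℝ) / 2)) ≤ (1 + w) ^ d := by
    rw [Real.rpow_neg hv.le, ← Real.inv_rpow hv.le, ← Real.rpow_natCast]
    calc w ^ ((d : ℝ) / 2) ≤ (1 + w) ^ ((d : ℝ) / 2) := by gcongr; linarith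
      _ ≤ (1 + w) ^ (d : ℝ) := by
        apply Real.rpow_le_rpow_of_exponent_le (by linarith)
        have : (0 : ℝ) ≤ d := Nat.cast_nonneg d
        linarith
  have h6 : (1 + w) ^ (d + 1) ≤ 4 ^ (d + 1) * (d + 1).factorial * Real.exp ((1 + w) / 4) := by
    have h := Real.pow_div_factorial_le_exp (n := d + 1) (x := (1 + w) / 4) (by positivity)
    rw [div_pow, div_div, div_le_iff₀ (by positivity)] at h
    linarith
  have h7 : Real.exp (-(1 / (4 * v))) = Real.exp (1 / 4) * (Real.exp ((1 + w) / 4))⁻¹ := by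
    rw [← Real.exp_neg, ← Real.exp_add]
    congr 1
    rw [hw]; field_simp; ring
  calc gaussianTime d v ≤ (1 + w) ^ d * (Real.exp (1 / 4) * (Real.exp ((1 + w) / 4))⁻¹) := by
        rw [gaussianTime, h7]; gcongr
    _ = (1 + w) ^ (d + 1) * (Real.exp (1 / 4) * (Real.exp ((1 + w) / 4))⁻¹) * (1 + w)⁻¹ := by
        rw [pow_succ]; field_simp
    _ ≤ (4 ^ (d + 1) * (d + 1).factorial * Real.exp ((1 + w) / 4)) *
          (Real.exp (1 / 4) * (Real.exp ((1 + w) / 4))⁻¹) * (1 + w)⁻¹ := by gcongr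
    _ = 4 ^ (d + 1) * (d + 1).factorial * Real.exp (1 / 4) * (1 + w)⁻¹ := by
        field_simp
    _ ≤ _ := by gcongr

/-- The difference `e^{-v} - e^{-2v}` is positive also for `v < ε`, where the kernel may be far
smaller. The rescaled subtracted term makes the left side nonpositive there; for `v ≥ ε` the kernel
is at least a constant times `e^{-v}`. -/
lemma le_gaussianTime (d : ℕ) {ε : ℝ} (hε : 0 < ε) : ∃ c : ℝ, 0 < c ∧ ∀ v, 0 < v →
    c * ((Real.exp (-v) - Real.exp (-(2 * v))) -
      ε * Real.exp 2 * (Real.exp (-(v / ε)) - Real.exp (-(2 * (v / ε))))) ≤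
      gaussianTime d v := by
  refine ⟨Real.exp (-(1 / (4 * ε))) * (d.factorial * Real.exp 1)⁻¹, by positivity, fun v hv => ?_⟩
  have hg0 : 0 ≤ gaussianTime d v := by unfold gaussianTime; positivity
  have hd0 : 0 ≤ Real.exp (-(v / ε)) - Real.exp (-(2 * (v / ε))) := by
    rw [sub_nonneg, Real.exp_le_exp]
    have : 0 < v / ε := by positivity
    linarith
  rcases le_total v ε with h | h
  · refine le_trans (mul_nonpos_of_nonneg_of_nonpos (by positivity) ?_) hg0
    have h1 := exp_neg_sub_exp_neg_le hv.le (by linarith : v ≤ 2 * v)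
    have h2 := le_exp_neg_sub_exp_neg (v / ε) (2 * (v / ε))
    have h3 : v / ε ≤ 1 := (div_le_one hε).2 h
    have h4 : (v / ε) * Real.exp (-2) ≤
        (2 * (v / ε) - v / ε) * Real.exp (-(2 * (v / ε))) := by
      have : (2 * (v / ε) - v / ε) = v / ε := by ring
      rw [this]
      gcongr
      linarith
    have h5 : v ≤ ε * Real.exp 2 * (Real.exp (-(v / ε)) - Real.exp (-(2 * (v / ε)))) := by
      calc v = ε * Real.exp 2 * ((v / ε) * Real.exp (-2)) := by
            rw [Real.exp_neg]; field_simp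
        _ ≤ _ := by gcongr; linarith
    linarith
  · have h1 : (Real.exp (-v) - Real.exp (-(2 * v))) -
      ε * Real.exp 2 * (Real.exp (-(v / ε)) - Real.exp (-(2 * (v / ε)))) ≤ Real.exp (-v) := by
      have : 0 ≤ ε * Real.exp 2 * (Real.exp (-(v / ε)) - Real.exp (-(2 * (v / ε)))) := by
        positivity
      have := Real.exp_pos (-(2 * v))
      linarith
    have h2 : v ^ ((d : ℝ) / 2) ≤ d.factorial * Real.exp 1 * Real.exp v := by
      have h3 := Real.pow_div_factorial_le_exp (n := d) (x := 1 + v) (by positivity)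
      rw [div_le_iff₀ (by positivity), Real.exp_add] at h3
      calc v ^ ((d : ℝ) / 2) ≤ (1 + v) ^ ((d : ℝ) / 2) := by gcongr; linarith
        _ ≤ (1 + v) ^ (d : ℝ) := by
          apply Real.rpow_le_rpow_of_exponent_le (by linarith)
          have : (0 : ℝ) ≤ d := Nat.cast_nonneg d
          linarith
        _ ≤ _ := by rw [Real.rpow_natCast]; linarith
    calc _ ≤ Real.exp (-(1 / (4 * ε))) * (d.factorial * Real.exp 1)⁻¹ * Real.exp (-v) := by gcongr
      _ = (d.factorial * Real.exp 1 * Real.exp v)⁻¹ * Real.exp (-(1 / (4 * ε))) := by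
        rw [Real.exp_neg v]; ring
      _ ≤ (v ^ ((d : ℝ) / 2))⁻¹ * Real.exp (-(1 / (4 * v))) := by gcongr
      _ = _ := by rw [gaussianTime, Real.rpow_neg hv.le]

end Elementary

/-! ### Monotonicity, continuity and tails of Gaussian mixtures -/

section Mixture

variable {d : ℕ} {μ : Measure ℝ}

lemma integrable_gaussianMixture (hpos : ∀ᵐ u ∂μ, 0 < u)
    (hint : Integrable (fun u : ℝ => u ^ (-((d : ℝ) / 2))) μ) (r : ℝ) :
    Integrable (fun u => u ^ (-((d : ℝ) / 2)) * Real.exp (-(r ^ 2 / (4 * u)))) μ := by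
  have hm : Measurable fun u : ℝ => Real.exp (-(r ^ 2 / (4 * u))) := by fun_prop
  refine hint.mul_bdd (c := 1) hm.aestronglyMeasurable ?_
  filter_upwards [hpos] with u hu
  rw [Real.norm_eq_abs, abs_of_pos (Real.exp_pos _), Real.exp_le_one_iff]
  simp only [Left.neg_nonpos_iff]; positivity

lemma gaussianMixture_strictAntiOn [NeZero μ] (hpos : ∀ᵐ u ∂μ, 0 < u)
    (hint : Integrable (fun u : ℝ => u ^ (-((d : ℝ) / 2))) μ) :
    StrictAntiOn (gaussianMixture d μ) (Ici 0) := by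
  intro r₁ hr₁ r₂ _ h
  have hlt : ∀ᵐ u ∂μ, u ^ (-((d : ℝ) / 2)) * Real.exp (-(r₂ ^ 2 / (4 * u))) <
      u ^ (-((d : ℝ) / 2)) * Real.exp (-(r₁ ^ 2 / (4 * u))) := by
    filter_upwards [hpos] with u hu
    have : r₁ ^ 2 < r₂ ^ 2 := pow_lt_pow_left₀ h hr₁ two_ne_zero
    gcongr
  rw [← sub_pos, gaussianMixture, gaussianMixture,
    ← integral_sub (integrable_gaussianMixture hpos hint _) (integrable_gaussianMixture hpos hint _),
    integral_pos_iff_support_of_nonneg_ae (hlt.mono fun u hu => (sub_pos.2 hu).le)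
      ((integrable_gaussianMixture hpos hint _).sub (integrable_gaussianMixture hpos hint _))]
  rw [pos_iff_ne_zero]
  intro h0
  have h1 := measure_eq_zero_iff_ae_notMem.1 h0
  have h2 : ∀ᵐ u ∂μ, False := by
    filter_upwards [h1, hlt] with u hu1 hu2
    exact hu1 (sub_pos.2 hu2).ne'
  rw [eventually_false_iff_eq_bot, ae_eq_bot] at h2
  exact NeZero.ne μ h2

lemma continuous_gaussianMixture (hpos : ∀ᵐ u ∂μ, 0 < u)
    (hint : Integrable (fun u : ℝ => u ^ (-((d : ℝ) / 2))) μ) :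
    Continuous (gaussianMixture d μ) := by
  refine continuous_of_dominated (bound := fun u => u ^ (-((d : ℝ) / 2)))
    (fun r => (integrable_gaussianMixture hpos hint r).aestronglyMeasurable) (fun r => ?_) hint ?_
  · filter_upwards [hpos] with u hu
    rw [Real.norm_eq_abs, abs_of_nonneg (by positivity)]
    refine mul_le_of_le_one_right (by positivity) (Real.exp_le_one_iff.2 ?_)
    simp only [Left.neg_nonpos_iff]; positivity
  · exact .of_forall fun u => by fun_prop

/-- Up to the factor `r^{-d}` the kernel depends on `u / r²` alone, so the tail is governed by the
Laplace transform at `x = r^{-2}`, where `x^{α/2} = r^{-α}`. -/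
lemma gaussianMixture_eq {r : ℝ} (hr : 0 < r) (hpos : ∀ᵐ u ∂μ, 0 < u) :
    gaussianMixture d μ r = r ^ (-(d : ℝ)) * ∫ u, gaussianTime d ((r ^ 2)⁻¹ * u) ∂μ := by
  rw [gaussianMixture, ← integral_const_mul]
  refine integral_congr_ae ?_
  filter_upwards [hpos] with u hu
  have h1 : ((r ^ 2)⁻¹ * u) ^ (-((d : ℝ) / 2)) = r ^ (d : ℝ) * u ^ (-((d : ℝ) / 2)) := by
    rw [Real.mul_rpow (by positivity) hu.le, Real.inv_rpow (by positivity),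
      Real.rpow_neg (by positivity), inv_inv, ← Real.rpow_natCast, ← Real.rpow_mul hr.le]
    congr 2
    push_cast; ring
  have h2 : r ^ (-(d : ℝ)) * r ^ (d : ℝ) = 1 := by
    rw [← Real.rpow_add hr]; simp
  rw [gaussianTime, h1, ← mul_assoc, ← mul_assoc, h2, one_mul]
  congr 3
  field_simp

lemma integrable_gaussianTime {r : ℝ} (hr : 0 < r) (hpos : ∀ᵐ u ∂μ, 0 < u)
    (hint : Integrable (fun u : ℝ => u ^ (-((d : ℝ) / 2))) μ) :
    Integrable (fun u => gaussianTime d ((r ^ 2)⁻¹ * u)) μ := by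
  refine ((integrable_gaussianMixture hpos hint r).const_mul (r ^ (d : ℝ))).congr ?_
  filter_upwards [hpos] with u hu
  have h1 : ((r ^ 2)⁻¹ * u) ^ (-((d : ℝ) / 2)) = r ^ (d : ℝ) * u ^ (-((d : ℝ) / 2)) := by
    rw [Real.mul_rpow (by positivity) hu.le, Real.inv_rpow (by positivity),
      Real.rpow_neg (by positivity), inv_inv, ← Real.rpow_natCast, ← Real.rpow_mul hr.le]
    congr 2
    push_cast; ring
  rw [gaussianTime, h1, ← mul_assoc]
  congr 3
  field_simp

lemma integrable_exp_neg_mul [IsProbabilityMeasure μ] (hpos : ∀ᵐ u ∂μ, 0 < u) {x : ℝ}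
    (hx : 0 < x) : Integrable (fun u => Real.exp (-(x * u))) μ := by
  refine Integrable.of_bound (by fun_prop) 1 ?_
  filter_upwards [hpos] with u hu
  rw [Real.norm_eq_abs, abs_of_pos (Real.exp_pos _), Real.exp_le_one_iff]
  simp only [Left.neg_nonpos_iff]; positivity

lemma inv_sq_rpow_half {r α : ℝ} (hr : 0 < r) : ((r ^ 2)⁻¹) ^ (α / 2) = r ^ (-α) := by
  rw [Real.inv_rpow (by positivity), ← Real.rpow_natCast, ← Real.rpow_mul hr.le, Real.rpow_neg hr.le]
  congr 2
  push_cast; ring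

/-- Integrating `gaussianTime_le` gives `1 - exp (-r^{-α})`, which is at most `r^{-α}`. -/
lemma gaussianMixture_le [IsProbabilityMeasure μ] {α : ℝ} (hpos : ∀ᵐ u ∂μ, 0 < u)
    (hL : ∀ x, 0 < x → ∫ u, Real.exp (-(x * u)) ∂μ = Real.exp (-x ^ (α / 2)))
    (hint : Integrable (fun u : ℝ => u ^ (-((d : ℝ) / 2))) μ) :
    ∃ C : ℝ, 0 < C ∧ ∀ r, 0 < r → gaussianMixture d μ r ≤ C * r ^ (-((d : ℝ) + α)) := by
  obtain ⟨C, hC, hφ⟩ := gaussianTime_le d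
  refine ⟨C, hC, fun r hr => ?_⟩
  have hs : 0 < (r ^ 2)⁻¹ := by positivity
  have hle : ∫ u, gaussianTime d ((r ^ 2)⁻¹ * u) ∂μ ≤ C * r ^ (-α) := by
    calc _ ≤ ∫ u, C * (1 - Real.exp (-((r ^ 2)⁻¹ * u))) ∂μ := by
          refine integral_mono_ae (integrable_gaussianTime hr hpos hint)
            (((integrable_const _).sub (integrable_exp_neg_mul hpos hs)).const_mul _) ?_
          filter_upwards [hpos] with u hu
          exact hφ _ (by positivity)
      _ = C * (1 - Real.exp (-r ^ (-α))) := by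
          rw [integral_const_mul, integral_sub (integrable_const _)
            (integrable_exp_neg_mul hpos hs), hL _ hs, inv_sq_rpow_half hr]
          simp
      _ ≤ _ := by
          have := Real.add_one_le_exp (-r ^ (-α))
          gcongr
          linarith
  rw [gaussianMixture_eq hr hpos, neg_add, Real.rpow_add hr]
  calc _ ≤ r ^ (-(d : ℝ)) * (C * r ^ (-α)) := by gcongr
    _ = _ := by ring

/-- After integrating `le_gaussianTime` at scale `s = r^{-2}`, the main term is of order `s^a` and
the correction of order `ε^{1-a} s^a`. Since `a = α/2 < 1`, a small `ε` makes the correction at most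
half the lower bound for the main term. -/
lemma le_gaussianMixture [IsProbabilityMeasure μ] {α : ℝ} (hα0 : 0 < α) (hα2 : α < 2)
    (hpos : ∀ᵐ u ∂μ, 0 < u)
    (hL : ∀ x, 0 < x → ∫ u, Real.exp (-(x * u)) ∂μ = Real.exp (-x ^ (α / 2)))
    (hint : Integrable (fun u : ℝ => u ^ (-((d : ℝ) / 2))) μ) :
    ∃ c : ℝ, 0 < c ∧ ∀ r, 1 ≤ r → c * r ^ (-((d : ℝ) + α)) ≤ gaussianMixture d μ r := by
  set a := α / 2 with ha
  have ha0 : 0 < a := by positivity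
  have ha1 : a < 1 := by rw [ha]; linarith
  -- Chosen so that `e² ε^{1-a} = e^{-2} / 2`, half of the factor `e^{-2}` in the lower bound `h1`.
  set ε : ℝ := (Real.exp (-4) / 2) ^ (1 / (1 - a)) with hε
  have hε0 : 0 < ε := by positivity
  have hεa : ε * ε ^ (-a) = Real.exp (-4) / 2 := by
    nth_rewrite 1 [← Real.rpow_one ε]
    rw [← Real.rpow_add hε0, hε, ← Real.rpow_mul (by positivity)]
    have : 1 / (1 - a) * (1 + -a) = 1 := by
      have : 1 - a ≠ 0 := by linarith
      field_simp; ring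
    rw [this, Real.rpow_one]
  obtain ⟨c, hc, hφ⟩ := le_gaussianTime d hε0
  have h2a : 1 < (2 : ℝ) ^ a := Real.one_lt_rpow one_lt_two ha0
  have h2a' : (2 : ℝ) ^ a ≤ 2 := by
    nth_rewrite 2 [← Real.rpow_one 2]
    exact Real.rpow_le_rpow_of_exponent_le one_le_two ha1.le
  refine ⟨c * (((2 : ℝ) ^ a - 1) * (Real.exp (-2) / 2)), by
    have := sub_pos.2 h2a
    positivity, fun r hr1 => ?_⟩
  have hr : 0 < r := by linarith
  have hs : 0 < (r ^ 2)⁻¹ := by positivity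
  set s := (r ^ 2)⁻¹ with hsdef
  have hsa : s ^ a = r ^ (-α) := inv_sq_rpow_half hr
  have hsa0 : 0 < s ^ a := by positivity
  -- Here `r ≥ 1` enters; it keeps the exponential factor in `h1` above `e^{-2}`.
  have hsa1 : s ^ a ≤ 1 := Real.rpow_le_one hs.le (inv_le_one_of_one_le₀ (one_le_pow₀ hr1)) ha0.le
  have hD : ∀ x, 0 < x → ∫ u, (Real.exp (-(x * u)) - Real.exp (-(2 * (x * u)))) ∂μ =
      Real.exp (-x ^ a) - Real.exp (-(2 ^ a * x ^ a)) := fun x hx => by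
    simp_rw [← mul_assoc]
    rw [integral_sub (integrable_exp_neg_mul hpos hx) (integrable_exp_neg_mul hpos (by positivity)),
      hL x hx, hL (2 * x) (by positivity), Real.mul_rpow zero_le_two hx.le]
  have hDi : ∀ x, 0 < x → Integrable (fun u => Real.exp (-(x * u)) - Real.exp (-(2 * (x * u)))) μ :=
    fun x hx => by
      simp_rw [← mul_assoc]
      exact (integrable_exp_neg_mul hpos hx).sub (integrable_exp_neg_mul hpos (by positivity))
  have hx' : ∀ u, s * u / ε = s / ε * u := fun u => by ring
  have hI := (hDi s hs).sub ((hDi (s / ε) (by positivity)).const_mul (ε * Real.exp 2))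
  have h1 : ((2 : ℝ) ^ a - 1) * s ^ a * Real.exp (-2) ≤
      Real.exp (-s ^ a) - Real.exp (-(2 ^ a * s ^ a)) := by
    have h := le_exp_neg_sub_exp_neg (s ^ a) (2 ^ a * s ^ a)
    refine le_trans ?_ h
    have h3 : (2 : ℝ) ^ a * s ^ a ≤ 2 := by nlinarith
    have h4 : (2 : ℝ) ^ a * s ^ a - s ^ a = ((2 : ℝ) ^ a - 1) * s ^ a := by ring
    rw [h4]
    have : 0 ≤ ((2 : ℝ) ^ a - 1) * s ^ a := by
      have := sub_pos.2 h2a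
      positivity
    gcongr
  have h2 : Real.exp (-(s / ε) ^ a) - Real.exp (-(2 ^ a * (s / ε) ^ a)) ≤
      ((2 : ℝ) ^ a - 1) * (s ^ a * ε ^ (-a)) := by
    have hq : (s / ε) ^ a = s ^ a * ε ^ (-a) := by
      rw [Real.div_rpow hs.le hε0.le, Real.rpow_neg hε0.le, div_eq_mul_inv]
    have h := exp_neg_sub_exp_neg_le (x := (s / ε) ^ a) (y := 2 ^ a * (s / ε) ^ a)
      (by positivity) (le_mul_of_one_le_left (by positivity) h2a.le)
    rw [hq] at h ⊢
    linarith
  have h3 : ((2 : ℝ) ^ a - 1) * (Real.exp (-2) / 2) * s ^ a ≤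
      (Real.exp (-s ^ a) - Real.exp (-(2 ^ a * s ^ a))) - ε * Real.exp 2 *
        (Real.exp (-(s / ε) ^ a) - Real.exp (-(2 ^ a * (s / ε) ^ a))) := by
    have h4 : ε * Real.exp 2 * (Real.exp (-(s / ε) ^ a) - Real.exp (-(2 ^ a * (s / ε) ^ a))) ≤
        ε * Real.exp 2 * (((2 : ℝ) ^ a - 1) * (s ^ a * ε ^ (-a))) := by gcongr
    have h5 : ε * Real.exp 2 * (((2 : ℝ) ^ a - 1) * (s ^ a * ε ^ (-a))) =
        ((2 : ℝ) ^ a - 1) * s ^ a * (Real.exp (-2) / 2) := by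
      have : Real.exp 2 * Real.exp (-4) = Real.exp (-2) := by
        rw [← Real.exp_add]; norm_num
      rw [← this]
      linear_combination (Real.exp 2 * ((2 : ℝ) ^ a - 1) * s ^ a) * hεa
    linarith
  have hle : c * (((2 : ℝ) ^ a - 1) * (Real.exp (-2) / 2)) * r ^ (-α) ≤
      ∫ u, gaussianTime d (s * u) ∂μ := by
    calc _ ≤ c * ((Real.exp (-s ^ a) - Real.exp (-(2 ^ a * s ^ a))) - ε * Real.exp 2 *
        (Real.exp (-(s / ε) ^ a) - Real.exp (-(2 ^ a * (s / ε) ^ a)))) := by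
          rw [← hsa, mul_assoc]; gcongr
      _ = ∫ u, c * ((Real.exp (-(s * u)) - Real.exp (-(2 * (s * u)))) - ε * Real.exp 2 *
            (Real.exp (-(s / ε * u)) - Real.exp (-(2 * (s / ε * u))))) ∂μ := by
          rw [integral_const_mul, integral_sub (hDi s hs)
            ((hDi (s / ε) (by positivity)).const_mul _), integral_const_mul, hD s hs,
            hD (s / ε) (by positivity)]
      _ ≤ _ := by
          refine integral_mono_ae (hI.const_mul c) (integrable_gaussianTime hr hpos hint) ?_
          filter_upwards [hpos] with u hu
          have := hφ (s * u) (by positivity)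
          rwa [hx'] at this
  rw [gaussianMixture_eq hr hpos, neg_add, Real.rpow_add hr]
  calc _ = r ^ (-(d : ℝ)) * (c * (((2 : ℝ) ^ a - 1) * (Real.exp (-2) / 2)) * r ^ (-α)) := by ring
    _ ≤ _ := by gcongr

end Mixture

/-! ### Scaling and the radial profile -/

lemma norm_rpow_smul_rpow {d : ℕ} {α s : ℝ} (hs : 0 < s) (hα0 : 0 < α) (ξ : EuclideanSpace ℝ (Fin d)) :
    ‖s ^ (1 / α) • ξ‖ ^ α = s * ‖ξ‖ ^ α := by
  rw [norm_smul, Real.norm_eq_abs, abs_of_pos (by positivity),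
    Real.mul_rpow (by positivity) (norm_nonneg _), ← Real.rpow_mul hs.le,
    one_div_mul_cancel hα0.ne', Real.rpow_one]

lemma rpow_one_div_pow {s : ℝ} (hs : 0 < s) (α : ℝ) (d : ℕ) :
    (s ^ (1 / α)) ^ d = s ^ ((d : ℝ) / α) := by
  rw [← Real.rpow_natCast, ← Real.rpow_mul hs.le]
  congr 1; ring

/-- Substitute `η = s^{1/α} ξ` in the Fourier integral. -/
lemma stableDensity_scaling {d : ℕ} {α : ℝ} (hα0 : 0 < α) {s : ℝ} (hs : 0 < s) (y : EuclideanSpace ℝ (Fin d)) :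
    stableDensity d α s y =
      (s ^ ((d : ℝ) / α))⁻¹ * stableDensity d α 1 ((s ^ (1 / α))⁻¹ • y) := by
  set R := s ^ (1 / α) with hR
  have hR0 : 0 < R := by positivity
  have h := Measure.integral_comp_smul (volume : Measure (EuclideanSpace ℝ (Fin d)))
    (fun η => Real.cos (inner ℝ (R⁻¹ • y) η) * Real.exp (-1 * ‖η‖ ^ α)) R
  have h1 : ∀ ξ : EuclideanSpace ℝ (Fin d),
      Real.cos (inner ℝ (R⁻¹ • y) (R • ξ)) * Real.exp (-1 * ‖R • ξ‖ ^ α) =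
      Real.cos (inner ℝ y ξ) * Real.exp (-s * ‖ξ‖ ^ α) := fun ξ => by
    rw [hR, norm_rpow_smul_rpow hs hα0, ← hR, real_inner_smul_left, real_inner_smul_right,
      inv_mul_cancel_left₀ hR0.ne']
    ring_nf
  simp_rw [h1] at h
  rw [stableDensity, h, stableDensity, finrank_euclideanSpace_fin, smul_eq_mul,
    abs_of_pos (by positivity), hR, rpow_one_div_pow hs]
  ring

section Profile

variable {d : ℕ} [NeZero d] {α : ℝ}

/-- The only place where the mixture representation is used; all later facts about the profile come
from these five properties. -/
lemma stableProfile_properties (hα0 : 0 < α) (hα2 : α < 2) :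
    (∀ x, stableDensity d α 1 x = stableProfile d α ‖x‖) ∧
    StrictAntiOn (stableProfile d α) (Ici 0) ∧ Continuous (stableProfile d α) ∧
    (∃ C, 0 < C ∧ ∀ r, 0 < r → stableProfile d α r ≤ C * r ^ (-((d : ℝ) + α))) ∧
    (∃ c, 0 < c ∧ ∀ r, 1 ≤ r → c * r ^ (-((d : ℝ) + α)) ≤ stableProfile d α r) := by
  obtain ⟨μ, hμ, hpos, hL, hint, c, hc, hp⟩ := exists_stableDensity_eq_gaussianMixture d hα0 hα2
  have hg : stableProfile d α = fun r => c * gaussianMixture d μ r := by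
    funext r
    rw [stableProfile, hp]
    simp [gaussianMixture]
  refine ⟨fun x => by rw [hp, hg], ?_, ?_, ?_, ?_⟩
  · rw [hg]
    exact fun r₁ h₁ r₂ h₂ h => mul_lt_mul_of_pos_left
      (gaussianMixture_strictAntiOn hpos hint h₁ h₂ h) hc
  · rw [hg]
    exact (continuous_gaussianMixture hpos hint).const_mul c
  · obtain ⟨C, hC, h⟩ := gaussianMixture_le hpos hL hint
    refine ⟨c * C, by positivity, fun r hr => ?_⟩
    rw [hg, mul_assoc]
    exact mul_le_mul_of_nonneg_left (h r hr) hc.le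
  · obtain ⟨C, hC, h⟩ := le_gaussianMixture hα0 hα2 hpos hL hint
    refine ⟨c * C, by positivity, fun r hr => ?_⟩
    rw [hg, mul_assoc]
    exact mul_le_mul_of_nonneg_left (h r hr) hc.le

lemma stableDensity_one_eq (hα0 : 0 < α) (hα2 : α < 2) (x : EuclideanSpace ℝ (Fin d)) :
    stableDensity d α 1 x = stableProfile d α ‖x‖ := (stableProfile_properties hα0 hα2).1 x

lemma stableProfile_strictAntiOn (hα0 : 0 < α) (hα2 : α < 2) :
    StrictAntiOn (stableProfile d α) (Ici 0) := (stableProfile_properties hα0 hα2).2.1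

lemma continuous_stableProfile (hα0 : 0 < α) (hα2 : α < 2) :
    Continuous (stableProfile d α) := (stableProfile_properties hα0 hα2).2.2.1

lemma stableProfile_pos (hα0 : 0 < α) (hα2 : α < 2) {r : ℝ} (hr : 0 ≤ r) :
    0 < stableProfile d α r := by
  obtain ⟨-, ha, -, -, c, hc, h⟩ := stableProfile_properties (d := d) hα0 hα2
  -- The lower tail bound starts at radius `1`, so positivity is read off at `r + 1` and carried
  -- back by monotonicity.
  have h1 : 0 < stableProfile d α (r + 1) :=
    lt_of_lt_of_le (by positivity) (h (r + 1) (by linarith))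
  exact h1.trans (ha hr (mem_Ici.2 (by linarith)) (by linarith))

lemma tendsto_stableProfile (hα0 : 0 < α) (hα2 : α < 2) :
    Tendsto (stableProfile d α) atTop (𝓝 0) := by
  obtain ⟨-, -, -, ⟨C, hC, h⟩, -⟩ := stableProfile_properties (d := d) hα0 hα2
  have ht : Tendsto (fun r : ℝ => C * r ^ (-((d : ℝ) + α))) atTop (𝓝 0) := by
    simpa using (tendsto_rpow_neg_atTop (by positivity : 0 < (d : ℝ) + α)).const_mul C
  refine squeeze_zero' ?_ ?_ ht
  · filter_upwards [eventually_ge_atTop 0] with r hr using (stableProfile_pos hα0 hα2 hr).le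
  · filter_upwards [eventually_gt_atTop 0] with r hr using h r hr

lemma exists_stableProfile_eq (hα0 : 0 < α) (hα2 : α < 2) {v : ℝ} (hv : 0 < v)
    (hv0 : v ≤ stableProfile d α 0) : ∃ r ∈ Ici (0 : ℝ), stableProfile d α r = v := by
  obtain ⟨R, hR, hR0⟩ := (((tendsto_stableProfile (d := d) hα0 hα2).eventually_lt_const hv).and
    (eventually_ge_atTop 0)).exists
  obtain ⟨r, hr, h⟩ := intermediate_value_Icc' hR0
    (continuous_stableProfile (d := d) hα0 hα2).continuousOn ⟨hR.le, hv0⟩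
  exact ⟨r, hr.1, h⟩

lemma stableProfileInv_nonneg (hα0 : 0 < α) (hα2 : α < 2) {v : ℝ} (hv : 0 < v)
    (hv0 : v ≤ stableProfile d α 0) : 0 ≤ stableProfileInv d α v :=
  Function.invFunOn_mem (exists_stableProfile_eq hα0 hα2 hv hv0)

lemma stableProfile_stableProfileInv (hα0 : 0 < α) (hα2 : α < 2) {v : ℝ} (hv : 0 < v)
    (hv0 : v ≤ stableProfile d α 0) : stableProfile d α (stableProfileInv d α v) = v :=
  Function.invFunOn_eq (exists_stableProfile_eq hα0 hα2 hv hv0)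

end Profile

/-! ### Volumes of superlevel sets -/

section LevelVolume

variable {d : ℕ} {α : ℝ}

/-- The volume of the superlevel set `{y | v < p_1(y)}`. -/
def levelVolume (d : ℕ) (α v : ℝ) : ℝ≥0∞ :=
  volume {y : EuclideanSpace ℝ (Fin d) | v < stableDensity d α 1 y}

lemma levelVolume_antitone : Antitone (levelVolume d α) := fun _ _ h =>
  measure_mono fun _ hy => lt_of_le_of_lt h hy

lemma measurable_levelVolume : Measurable (levelVolume d α) := levelVolume_antitone.measurable

lemma volume_lt_stableDensity (hα0 : 0 < α) {s : ℝ} (hs : 0 < s) (w : ℝ) :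
    volume {y : EuclideanSpace ℝ (Fin d) | w < stableDensity d α s y} =
      ENNReal.ofReal (s ^ ((d : ℝ) / α)) * levelVolume d α (s ^ ((d : ℝ) / α) * w) := by
  have hR0 : (s ^ (1 / α))⁻¹ ≠ 0 := by positivity
  have hset : {y : EuclideanSpace ℝ (Fin d) | w < stableDensity d α s y} =
      (fun y => (s ^ (1 / α))⁻¹ • y) ⁻¹' {y | s ^ ((d : ℝ) / α) * w < stableDensity d α 1 y} := by
    ext y
    simp only [mem_ofPred_eq, mem_preimage]
    rw [stableDensity_scaling hα0 hs y, lt_inv_mul_iff₀ (by positivity)]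
  rw [hset, Measure.addHaar_preimage_smul _ hR0, finrank_euclideanSpace_fin, levelVolume]
  congr 2
  rw [inv_pow, inv_inv, rpow_one_div_pow hs, abs_of_pos (by positivity)]

variable [NeZero d]

lemma levelVolume_eq_zero (hα0 : 0 < α) (hα2 : α < 2) {v : ℝ} (hv : stableProfile d α 0 ≤ v) :
    levelVolume d α v = 0 := by
  have : {y : EuclideanSpace ℝ (Fin d) | v < stableDensity d α 1 y} = ∅ := by
    ext y
    simp only [mem_ofPred_eq, mem_empty_iff_false, iff_false, not_lt]
    rw [stableDensity_one_eq hα0 hα2]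
    exact ((stableProfile_strictAntiOn hα0 hα2).antitoneOn self_mem_Ici (norm_nonneg y)
      (norm_nonneg y)).trans hv
  rw [levelVolume, this, measure_empty]

lemma volume_ball_eq_mul {ρ : ℝ} (hρ : 0 ≤ ρ) :
    volume (Metric.ball (0 : EuclideanSpace ℝ (Fin d)) ρ) =
      volume (Metric.ball (0 : EuclideanSpace ℝ (Fin d)) 1) * ENNReal.ofReal (ρ ^ d) := by
  rw [Measure.addHaar_ball volume _ hρ, finrank_euclideanSpace_fin, mul_comm]

lemma levelVolume_eq (hα0 : 0 < α) (hα2 : α < 2) {v : ℝ} (hv : 0 < v)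
    (hv0 : v < stableProfile d α 0) :
    levelVolume d α v = volume (Metric.ball (0 : EuclideanSpace ℝ (Fin d)) 1) *
      ENNReal.ofReal (stableProfileInv d α v ^ d) := by
  have h0 := stableProfileInv_nonneg hα0 hα2 hv hv0.le
  rw [levelVolume, ← volume_ball_eq_mul h0]
  congr 1
  ext y
  simp only [mem_ofPred_eq, mem_ball_zero_iff]
  rw [stableDensity_one_eq hα0 hα2]
  nth_rewrite 1 [← stableProfile_stableProfileInv hα0 hα2 hv hv0.le]
  exact (stableProfile_strictAntiOn hα0 hα2).lt_iff_gt h0 (norm_nonneg y)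

/-- Inverting `g(r) ≤ C r^{-(d+α)}` encloses the superlevel set in a ball of radius
`(C/v)^{1/(d+α)}`. -/
lemma levelVolume_le (hα0 : 0 < α) (hα2 : α < 2) : ∃ C : ℝ≥0, ∀ v, 0 < v →
    levelVolume d α v ≤ C * ENNReal.ofReal (v ^ (-((d : ℝ) / (d + α)))) := by
  obtain ⟨-, -, -, ⟨C, hC, h⟩, -⟩ := stableProfile_properties (d := d) hα0 hα2
  have hd : 0 < (d : ℝ) + α := by positivity
  refine ⟨(volume (Metric.ball (0 : EuclideanSpace ℝ (Fin d)) 1)).toNNReal *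
    (C ^ ((d : ℝ) / (d + α))).toNNReal, fun v hv => ?_⟩
  set ρ : ℝ := (C / v) ^ (1 / ((d : ℝ) + α)) with hρ
  have hsub : {y : EuclideanSpace ℝ (Fin d) | v < stableDensity d α 1 y} ⊆
      Metric.closedBall 0 ρ := by
    intro y hy
    rw [mem_ofPred_eq, stableDensity_one_eq hα0 hα2] at hy
    rw [mem_closedBall_zero_iff]
    rcases (norm_nonneg y).eq_or_lt with h0 | h0
    · rw [← h0]; positivity
    · have h1 := hy.trans_le (h _ h0)
      rw [Real.rpow_neg h0.le, ← div_eq_mul_inv, lt_div_iff₀ (by positivity)] at h1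
      have h2 : ‖y‖ ^ ((d : ℝ) + α) ≤ C / v := by
        rw [le_div_iff₀ hv]; linarith
      calc ‖y‖ = (‖y‖ ^ ((d : ℝ) + α)) ^ (1 / ((d : ℝ) + α)) := by
            rw [← Real.rpow_mul h0.le, mul_one_div_cancel hd.ne', Real.rpow_one]
        _ ≤ _ := by rw [hρ]; gcongr
  refine (measure_mono hsub).trans ?_
  rw [Measure.addHaar_closedBall volume _ (by positivity), finrank_euclideanSpace_fin]
  have h3 : ρ ^ d = C ^ ((d : ℝ) / (d + α)) * v ^ (-((d : ℝ) / (d + α))) := by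
    rw [hρ, ← Real.rpow_natCast, ← Real.rpow_mul (by positivity), Real.div_rpow hC.le hv.le,
      Real.rpow_neg hv.le]
    have : 1 / ((d : ℝ) + α) * d = d / (d + α) := by ring
    rw [this, div_eq_mul_inv]
  rw [h3, ENNReal.ofReal_mul (by positivity), ENNReal.coe_mul,
    ENNReal.coe_toNNReal measure_ball_lt_top.ne]
  apply le_of_eq
  rw [ENNReal.ofReal]
  ring

lemma le_levelVolume (hα0 : 0 < α) (hα2 : α < 2) : ∃ c : ℝ≥0, 0 < c ∧ ∃ v₀ : ℝ, 0 < v₀ ∧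
    ∀ v, 0 < v → v ≤ v₀ →
    c * ENNReal.ofReal (v ^ (-((d : ℝ) / (d + α)))) ≤ levelVolume d α v := by
  obtain ⟨-, hanti, -, -, C, hC, h⟩ := stableProfile_properties (d := d) hα0 hα2
  have hd : 0 < (d : ℝ) + α := by positivity
  have hω : 0 < (volume (Metric.ball (0 : EuclideanSpace ℝ (Fin d)) 1)).toNNReal :=
    ENNReal.toNNReal_pos (Metric.measure_ball_pos _ _ one_pos).ne' measure_ball_lt_top.ne
  refine ⟨(volume (Metric.ball (0 : EuclideanSpace ℝ (Fin d)) 1)).toNNReal *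
    (C ^ ((d : ℝ) / (d + α))).toNNReal, mul_pos hω (Real.toNNReal_pos.2 (by positivity)), C, hC,
    fun v hv hvC => ?_⟩
  set ρ : ℝ := (C / v) ^ (1 / ((d : ℝ) + α)) with hρ
  -- The threshold `v₀ = C` is what makes the radius at least `1`, where the lower profile bound
  -- holds.
  have hρ1 : 1 ≤ ρ := Real.one_le_rpow ((one_le_div hv).2 hvC) (by positivity)
  have hsub : Metric.ball 0 ρ ⊆ {y : EuclideanSpace ℝ (Fin d) | v < stableDensity d α 1 y} := by
    intro y hy
    rw [mem_ball_zero_iff] at hy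
    rw [mem_ofPred_eq, stableDensity_one_eq hα0 hα2]
    refine lt_of_le_of_lt ?_ (hanti (norm_nonneg y) (mem_Ici.2 (by linarith)) hy)
    refine le_trans (le_of_eq ?_) (h ρ hρ1)
    rw [hρ, ← Real.rpow_mul (by positivity)]
    have : 1 / ((d : ℝ) + α) * (-(d + α)) = -1 := by field_simp
    rw [this, Real.rpow_neg_one]
    field_simp
  refine le_trans (le_of_eq ?_) (measure_mono hsub)
  rw [volume_ball_eq_mul (ρ := ρ) (by positivity)]
  have h3 : ρ ^ d = C ^ ((d : ℝ) / (d + α)) * v ^ (-((d : ℝ) / (d + α))) := by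
    rw [hρ, ← Real.rpow_natCast, ← Real.rpow_mul (by positivity), Real.div_rpow hC.le hv.le,
      Real.rpow_neg hv.le]
    have : 1 / ((d : ℝ) + α) * d = d / (d + α) := by ring
    rw [this, div_eq_mul_inv]
  rw [h3, ENNReal.ofReal_mul (by positivity), ENNReal.coe_mul,
    ENNReal.coe_toNNReal measure_ball_lt_top.ne, ENNReal.ofReal, ENNReal.ofReal]
  ring

end LevelVolume

/-! ### Finiteness properties of the Lévy measure -/

lemma IsLevyMeasureOnPos.measure_Ioi_lt_top {lam : Measure ℝ} (h : IsLevyMeasureOnPos lam) {ε : ℝ}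
    (hε : 0 < ε) : lam (Ioi ε) < ∞ := by
  have hc : 0 < min 1 (ε ^ 2) := by positivity
  have h1 := mul_meas_ge_le_lintegral (μ := lam.restrict (Ioi 0))
    (f := fun z : ℝ => ENNReal.ofReal (min 1 (z ^ 2))) (by fun_prop)
    (ENNReal.ofReal (min 1 (ε ^ 2)))
  have h2 : lam (Ioi ε) ≤ lam.restrict (Ioi 0)
      {z : ℝ | ENNReal.ofReal (min 1 (ε ^ 2)) ≤ ENNReal.ofReal (min 1 (z ^ 2))} := by
    rw [← inter_eq_self_of_subset_left (Ioi_subset_Ioi hε.le),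
      ← Measure.restrict_apply measurableSet_Ioi]
    refine measure_mono fun z hz => ENNReal.ofReal_le_ofReal ?_
    have : ε < z := hz
    gcongr
  have h3 := (mul_le_mul_right h2 (ENNReal.ofReal (min 1 (ε ^ 2)))).trans_lt
    (h1.trans_lt h.integral_lt_top)
  by_contra hn
  rw [not_lt, top_le_iff] at hn
  rw [hn, ENNReal.mul_top (by simpa using hε.ne')] at h3
  exact lt_irrefl _ h3

lemma IsLevyMeasureOnPos.sigmaFinite {lam : Measure ℝ} (h : IsLevyMeasureOnPos lam) :
    SigmaFinite lam := by
  refine Measure.sigmaFinite_of_countable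
    (S := insert (Iic 0) (range fun n : ℕ => Ioi (1 / ((n : ℝ) + 1))))
    ((countable_range _).insert _) ?_ ?_
  · rintro s (rfl | ⟨n, rfl⟩)
    · rw [h.carried]; simp
    · exact h.measure_Ioi_lt_top (by positivity)
  · rw [sUnion_insert, eq_univ_iff_forall]
    intro z
    rcases le_or_gt z 0 with hz | hz
    · exact Or.inl hz
    · obtain ⟨n, hn⟩ := exists_nat_one_div_lt hz
      exact Or.inr ⟨_, ⟨n, rfl⟩, hn⟩

lemma IsLevyMeasureOnPos.restrict_Ioi {lam : Measure ℝ} (h : IsLevyMeasureOnPos lam) :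
    lam.restrict (Ioi 0) = lam := by
  refine Measure.restrict_eq_self_of_ae_mem ?_
  have := measure_eq_zero_iff_ae_notMem.1 h.carried
  filter_upwards [this] with z hz
  exact notMem_Iic.1 hz

/-! ### The integral formula for the tail of `η` -/

section Tail

variable {d : ℕ} {α : ℝ}

/-- The truncated moment `x ↦ ∫ v ^ (α/d) |{p_1 > v}| dv` over `(0, x]`. -/
def truncatedMoment (d : ℕ) (α x : ℝ) : ℝ≥0∞ :=
  ∫⁻ v in Ioc 0 x, ENNReal.ofReal (v ^ (α / d)) * levelVolume d α v

lemma image_div_rpow_Ioc {β κ x : ℝ} (hβ : 0 < β) (hκ : 0 < κ) (hx : 0 < x) :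
    (fun v : ℝ => (v / κ) ^ β) '' Ioc 0 (x ^ β⁻¹ * κ) = Ioc 0 x := by
  ext s
  constructor
  · rintro ⟨v, ⟨hv0, hv⟩, rfl⟩
    refine ⟨by positivity, ?_⟩
    rw [← div_le_iff₀ hκ] at hv
    calc (v / κ) ^ β ≤ (x ^ β⁻¹) ^ β := by gcongr
      _ = x := by rw [← Real.rpow_mul hx.le, inv_mul_cancel₀ hβ.ne', Real.rpow_one]
  · rintro ⟨hs0, hs⟩
    refine ⟨s ^ β⁻¹ * κ, ⟨by positivity, by gcongr⟩, ?_⟩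
    dsimp only
    rw [mul_div_cancel_right₀ _ hκ.ne', ← Real.rpow_mul hs0.le, inv_mul_cancel₀ hβ.ne',
      Real.rpow_one]

/-- Change of variables `s = (v/κ)^{α/d}`; its Jacobian produces the weight `v^{α/d}` and the power
of `κ`. -/
lemma lintegral_levelVolume_scaled [NeZero d] (hα0 : 0 < α) {t κ : ℝ} (ht : 0 < t) (hκ : 0 < κ) :
    ∫⁻ s in Ioc 0 t, ENNReal.ofReal (s ^ ((d : ℝ) / α)) *
        levelVolume d α (s ^ ((d : ℝ) / α) * κ) =
      ENNReal.ofReal (α / d * κ ^ (-(1 + α / d))) *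
        truncatedMoment d α (t ^ ((d : ℝ) / α) * κ) := by
  have hβ : 0 < α / d := by have := NeZero.pos d; positivity
  set β := α / d with hβdef
  have hinv : (d : ℝ) / α = β⁻¹ := by rw [hβdef, inv_div]
  rw [hinv]
  have hderiv : ∀ v ∈ Ioc 0 (t ^ β⁻¹ * κ), HasDerivWithinAt (fun v : ℝ => (v / κ) ^ β)
      (κ⁻¹ * β * (v / κ) ^ (β - 1)) (Ioc 0 (t ^ β⁻¹ * κ)) v := fun v hv => by
    have h1 : HasDerivAt (fun v : ℝ => v / κ) κ⁻¹ v := by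
      simpa using (hasDerivAt_id v).div_const κ
    have h2 := h1.rpow_const (p := β) (Or.inl (div_pos hv.1 hκ).ne')
    exact h2.hasDerivWithinAt
  have hinj : InjOn (fun v : ℝ => (v / κ) ^ β) (Ioc 0 (t ^ β⁻¹ * κ)) := by
    intro v hv w hw h
    have h2 := (Real.rpow_left_inj (div_pos hv.1 hκ).le (div_pos hw.1 hκ).le hβ.ne').1 h
    exact (div_left_inj' hκ.ne').1 h2
  rw [← image_div_rpow_Ioc hβ hκ ht,
    lintegral_image_eq_lintegral_abs_deriv_mul measurableSet_Ioc hderiv hinj, truncatedMoment,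
    ← lintegral_const_mul' _ _ ENNReal.ofReal_ne_top]
  refine setLIntegral_congr_fun measurableSet_Ioc fun v hv => ?_
  have hvκ : 0 < v / κ := div_pos hv.1 hκ
  rw [← Real.rpow_mul hvκ.le, mul_inv_cancel₀ hβ.ne', Real.rpow_one, div_mul_cancel₀ _ hκ.ne',
    ← mul_assoc, ← mul_assoc, abs_of_pos (by positivity), ← ENNReal.ofReal_mul (by positivity),
    ← ENNReal.ofReal_mul (by positivity)]
  congr 2
  rw [mul_assoc]
  have h1 : (v / κ) ^ (β - 1) * (v / κ) = (v / κ) ^ β := by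
    nth_rewrite 2 [← Real.rpow_one (v / κ)]
    rw [← Real.rpow_add hvκ, sub_add_cancel]
  rw [h1, Real.div_rpow hv.1.le hκ.le, neg_add, Real.rpow_add hκ, Real.rpow_neg_one,
    Real.rpow_neg hκ.le]
  ring

lemma measurableSet_jump [NeZero d] (hα0 : 0 < α) (hα2 : α < 2) (t r : ℝ) :
    MeasurableSet {q : ℝ × EuclideanSpace ℝ (Fin d) × ℝ | q.1 ∈ Ioc 0 t ∧ q.2.2 ∈ Ioi (0 : ℝ) ∧
      stableDensity d α q.1 q.2.1 * q.2.2 ∈ Ioi r} := by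
  -- For `s > 0` scaling expresses the density through the continuous profile, which makes joint
  -- measurability immediate.
  have heq : {q : ℝ × EuclideanSpace ℝ (Fin d) × ℝ | q.1 ∈ Ioc 0 t ∧ q.2.2 ∈ Ioi (0 : ℝ) ∧
      stableDensity d α q.1 q.2.1 * q.2.2 ∈ Ioi r} =
      {q | q.1 ∈ Ioc 0 t ∧ q.2.2 ∈ Ioi (0 : ℝ) ∧ (q.1 ^ ((d : ℝ) / α))⁻¹ *
        stableProfile d α ‖(q.1 ^ (1 / α))⁻¹ • q.2.1‖ * q.2.2 ∈ Ioi r} := by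
    ext q
    refine and_congr_right fun hq => and_congr_right fun _ => ?_
    rw [stableDensity_scaling hα0 hq.1, stableDensity_one_eq hα0 hα2]
  rw [heq]
  have hg := (continuous_stableProfile (d := d) hα0 hα2).measurable
  have hm : Measurable fun q : ℝ × EuclideanSpace ℝ (Fin d) × ℝ => (q.1 ^ ((d : ℝ) / α))⁻¹ *
        stableProfile d α ‖(q.1 ^ (1 / α))⁻¹ • q.2.1‖ * q.2.2 := by
    fun_prop
  exact (measurable_fst measurableSet_Ioc).inter
    (((measurable_snd.comp measurable_snd) measurableSet_Ioi).inter (hm measurableSet_Ioi))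

/-- Tonelli: the `y`-integral gives the volume of `{p_s > r/z}`, and the `s`-integral is then
`lintegral_levelVolume_scaled` with `κ = r/z`. -/
lemma etaTail_eq [NeZero d] (hα0 : 0 < α) (hα2 : α < 2) {t : ℝ} (ht : 0 < t) {lam : Measure ℝ}
    (hlam : IsLevyMeasureOnPos lam) {r : ℝ} (hr : 0 < r) :
    etaTail d α t lam r = ∫⁻ z in Ioi 0, ENNReal.ofReal (α / d * (r / z) ^ (-(1 + α / d))) *
      truncatedMoment d α (t ^ ((d : ℝ) / α) * (r / z)) ∂lam := by
  have hσ := hlam.sigmaFinite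
  have hS := measurableSet_jump (d := d) hα0 hα2 t r
  rw [etaTail, etaMeasure, noiseIntensity, Measure.prod_apply hS]
  have h1 : ∀ s ∈ Ioi (0 : ℝ), ((volume : Measure (EuclideanSpace ℝ (Fin d))).prod
      (lam.restrict (Ioi (0 : ℝ)))) (Prod.mk s ⁻¹' {q : ℝ × EuclideanSpace ℝ (Fin d) × ℝ |
        q.1 ∈ Ioc 0 t ∧ q.2.2 ∈ Ioi (0 : ℝ) ∧ stableDensity d α q.1 q.2.1 * q.2.2 ∈ Ioi r}) =
      (Ioc 0 t).indicator (fun s => ∫⁻ z in Ioi 0, ENNReal.ofReal (s ^ ((d : ℝ) / α)) *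
        levelVolume d α (s ^ ((d : ℝ) / α) * (r / z)) ∂lam) s := by
    intro s hs
    rw [Measure.prod_apply_symm (measurable_prodMk_left hS)]
    by_cases hst : s ∈ Ioc 0 t
    · rw [indicator_of_mem hst]
      refine setLIntegral_congr_fun measurableSet_Ioi fun z hz => ?_
      rw [← volume_lt_stableDensity hα0 hs]
      congr 1
      ext y
      have hz0 : 0 < z := hz
      simp only [mem_preimage, mem_ofPred_eq, mem_Ioi, hst, hz0, true_and, div_lt_iff₀]
    · rw [indicator_of_notMem hst]
      refine (lintegral_congr fun z => ?_).trans lintegral_zero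
      exact measure_mono_null (fun y hy => hst hy.1) measure_empty
  rw [setLIntegral_congr_fun measurableSet_Ioi h1, lintegral_indicator measurableSet_Ioc,
    Measure.restrict_restrict measurableSet_Ioc, inter_eq_self_of_subset_left Ioc_subset_Ioi_self,
    lintegral_lintegral_swap]
  · refine setLIntegral_congr_fun measurableSet_Ioi fun z hz => ?_
    exact lintegral_levelVolume_scaled hα0 ht (div_pos hr hz)
  · have hm : Measurable (levelVolume d α) := measurable_levelVolume
    refine Measurable.aemeasurable ?_
    simp only [Function.uncurry_def]
    fun_prop

end Tail

/-! ### Behaviour of the truncated moment, and statement (i) -/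

lemma lintegral_Ioc_zero_rpow {e x : ℝ} (he : -1 < e) (hx : 0 ≤ x) :
    ∫⁻ v in Ioc 0 x, ENNReal.ofReal (v ^ e) = ENNReal.ofReal (x ^ (e + 1) / (e + 1)) := by
  rw [← ofReal_integral_eq_lintegral_ofReal, ← intervalIntegral.integral_of_le hx,
    integral_rpow (Or.inl he), Real.zero_rpow (by linarith), sub_zero]
  · exact (intervalIntegrable_iff_integrableOn_Ioc_of_le hx).1
      (intervalIntegral.intervalIntegrable_rpow' he)
  · filter_upwards [ae_restrict_mem measurableSet_Ioc] with v hv using Real.rpow_nonneg hv.1.le _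

lemma lintegral_Ioi_comp_div {f : ℝ → ℝ≥0∞} {z : ℝ} (hz : 0 < z) :
    ∫⁻ u in Ioi 0, f (u / z) = ENNReal.ofReal z * ∫⁻ v in Ioi 0, f v := by
  have himg : (fun v : ℝ => z * v) '' Ioi 0 = Ioi 0 := by
    rw [image_mul_left_Ioi hz, mul_zero]
  nth_rewrite 1 [← himg]
  rw [lintegral_image_eq_lintegral_abs_deriv_mul (f' := fun _ => z) measurableSet_Ioi
    (fun v _ => by simpa using ((hasDerivAt_id v).const_mul z).hasDerivWithinAt)
    (fun v _ w _ h => mul_left_cancel₀ hz.ne' h), abs_of_pos hz,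
    lintegral_const_mul' _ _ ENNReal.ofReal_ne_top]
  simp_rw [mul_div_cancel_left₀ _ hz.ne']

section Moment

variable {d : ℕ} {α : ℝ}

lemma truncatedMoment_mono : Monotone (truncatedMoment d α) := fun _ _ h =>
  lintegral_mono_set (Ioc_subset_Ioc_right h)

lemma exponent_pos [NeZero d] (hα0 : 0 < α) : 0 < α / d - (d : ℝ) / (d + α) + 1 := by
  have hd : (0 : ℝ) < d := by exact_mod_cast NeZero.pos d
  have h1 : (d : ℝ) / (d + α) < 1 := (div_lt_one (by positivity)).2 (by linarith)
  have h2 : 0 < α / d := by positivity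
  linarith

lemma rpow_mul_rpow_neg {v a b : ℝ} (hv : 0 < v) :
    ENNReal.ofReal (v ^ a) * ENNReal.ofReal (v ^ (-b)) = ENNReal.ofReal (v ^ (a - b)) := by
  rw [← ENNReal.ofReal_mul (by positivity), ← Real.rpow_add hv, sub_eq_add_neg]

variable [NeZero d]

lemma truncatedMoment_le (hα0 : 0 < α) (hα2 : α < 2) : ∃ C : ℝ≥0, ∀ x, 0 ≤ x →
    truncatedMoment d α x ≤ C * ENNReal.ofReal (x ^ (1 + α / d - (d : ℝ) / (d + α))) := by
  obtain ⟨C, hC⟩ := levelVolume_le (d := d) hα0 hα2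
  have he := exponent_pos (d := d) hα0
  refine ⟨C * (1 / (α / d - (d : ℝ) / (d + α) + 1)).toNNReal, fun x hx => ?_⟩
  calc truncatedMoment d α x
      ≤ ∫⁻ v in Ioc 0 x, C * ENNReal.ofReal (v ^ (α / d - (d : ℝ) / (d + α))) := by
        refine setLIntegral_mono' measurableSet_Ioc fun v hv => ?_
        rw [← rpow_mul_rpow_neg hv.1]
        calc _ ≤ ENNReal.ofReal (v ^ (α / d)) *
              (C * ENNReal.ofReal (v ^ (-((d : ℝ) / (d + α))))) := by gcongr; exact hC v hv.1
          _ = _ := by ring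
    _ = _ := by
      rw [lintegral_const_mul' _ _ ENNReal.coe_ne_top, lintegral_Ioc_zero_rpow (by linarith) hx,
        ENNReal.coe_mul, mul_assoc, ← ENNReal.ofReal, ← ENNReal.ofReal_mul (by positivity)]
      congr 2
      rw [one_div_mul_eq_div]
      congr 2; ring

lemma truncatedMoment_le_const (hα0 : 0 < α) (hα2 : α < 2) (x : ℝ) :
    truncatedMoment d α x ≤ truncatedMoment d α (stableProfile d α 0) := by
  rcases le_total x (stableProfile d α 0) with h | h
  · exact truncatedMoment_mono h
  · have h0 := (stableProfile_pos (d := d) hα0 hα2 le_rfl).le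
    rw [truncatedMoment, ← Ioc_union_Ioc_eq_Ioc h0 h]
    refine (lintegral_union_le _ _ _).trans ?_
    rw [setLIntegral_congr_fun (g := 0) (s := Ioc (stableProfile d α 0) x) measurableSet_Ioc
      (fun v hv => by simp [levelVolume_eq_zero hα0 hα2 hv.1.le])]
    simp [truncatedMoment]

lemma truncatedMoment_eq_const (hα0 : 0 < α) (hα2 : α < 2) {x : ℝ} (hx : stableProfile d α 0 ≤ x) :
    truncatedMoment d α x = truncatedMoment d α (stableProfile d α 0) :=
  le_antisymm (truncatedMoment_le_const hα0 hα2 x) (truncatedMoment_mono hx)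

lemma truncatedMoment_profile_ne_top (hα0 : 0 < α) (hα2 : α < 2) :
    truncatedMoment d α (stableProfile d α 0) ≠ ∞ := by
  obtain ⟨C, hC⟩ := truncatedMoment_le (d := d) hα0 hα2
  exact ne_top_of_le_ne_top (ENNReal.mul_ne_top ENNReal.coe_ne_top ENNReal.ofReal_ne_top)
    (hC _ (stableProfile_pos (d := d) hα0 hα2 le_rfl).le)

lemma le_truncatedMoment (hα0 : 0 < α) (hα2 : α < 2) : ∃ c : ℝ≥0, 0 < c ∧ ∃ v₀ : ℝ, 0 < v₀ ∧
    ∀ x, 0 ≤ x → x ≤ v₀ →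
    c * ENNReal.ofReal (x ^ (1 + α / d - (d : ℝ) / (d + α))) ≤ truncatedMoment d α x := by
  obtain ⟨C, hC0, v₀, hv₀, hC⟩ := le_levelVolume (d := d) hα0 hα2
  have he := exponent_pos (d := d) hα0
  refine ⟨C * (1 / (α / d - (d : ℝ) / (d + α) + 1)).toNNReal,
    mul_pos hC0 (Real.toNNReal_pos.2 (by positivity)), v₀, hv₀, fun x hx hx0 => ?_⟩
  calc _ = ∫⁻ v in Ioc 0 x, C * ENNReal.ofReal (v ^ (α / d - (d : ℝ) / (d + α))) := by
        rw [lintegral_const_mul' _ _ ENNReal.coe_ne_top, lintegral_Ioc_zero_rpow (by linarith) hx,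
          ENNReal.coe_mul, mul_assoc, ← ENNReal.ofReal, ← ENNReal.ofReal_mul (by positivity)]
        congr 2
        rw [one_div_mul_eq_div]
        congr 2; ring
    _ ≤ truncatedMoment d α x := by
        refine setLIntegral_mono' measurableSet_Ioc fun v hv => ?_
        rw [← rpow_mul_rpow_neg hv.1]
        calc _ = ENNReal.ofReal (v ^ (α / d)) *
              (C * ENNReal.ofReal (v ^ (-((d : ℝ) / (d + α))))) := by ring
          _ ≤ _ := by gcongr; exact hC v hv.1 (hv.2.trans hx0)

lemma truncatedMoment_pos (hα0 : 0 < α) (hα2 : α < 2) {x : ℝ} (hx : 0 < x) :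
    0 < truncatedMoment d α x := by
  obtain ⟨c, hc, v₀, hv₀, h⟩ := le_truncatedMoment (d := d) hα0 hα2
  have hm : 0 < min x v₀ := lt_min hx hv₀
  refine lt_of_lt_of_le ?_ ((h (min x v₀) hm.le (min_le_right _ _)).trans
    (truncatedMoment_mono (min_le_left _ _)))
  exact ENNReal.mul_pos (by simpa using hc.ne')
    (ENNReal.ofReal_pos.2 (by positivity)).ne'

lemma lintegral_Ioi_levelVolume (hα0 : 0 < α) (hα2 : α < 2) :
    ∫⁻ v in Ioi 0, ENNReal.ofReal (v ^ (α / d)) * levelVolume d α v =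
      truncatedMoment d α (stableProfile d α 0) := by
  rw [truncatedMoment, ← Ioc_union_Ioi_eq_Ioi (stableProfile_pos (d := d) hα0 hα2 le_rfl).le,
    lintegral_union measurableSet_Ioi (Ioc_disjoint_Ioi le_rfl),
    setLIntegral_congr_fun (g := 0) (s := Ioi (stableProfile d α 0)) measurableSet_Ioi
      (fun v hv => by simp [levelVolume_eq_zero hα0 hα2 (mem_Ioi.1 hv).le])]
  simp

/-- The inner integrand times `ω_d` is the volume of `{p_1 > u/z}`, a set that is empty when `z ≤
u/g(0)`. Tonelli and `u = z v` separate the variables. -/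
lemma lintegral_stableProfileInv_eq (hα0 : 0 < α) (hα2 : α < 2) {lam : Measure ℝ} [SFinite lam] :
    volume (Metric.ball (0 : EuclideanSpace ℝ (Fin d)) 1) *
      ∫⁻ u in Ioi (0 : ℝ), ENNReal.ofReal (u ^ (α / d)) *
        ∫⁻ z in Ioi (u / stableProfile d α 0),
          ENNReal.ofReal (stableProfileInv d α (u / z) ^ d) ∂lam =
      truncatedMoment d α (stableProfile d α 0) *
        ∫⁻ z in Ioi 0, ENNReal.ofReal (z ^ (1 + α / d)) ∂lam := by
  have hg := stableProfile_pos (d := d) hα0 hα2 le_rfl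
  set ω := volume (Metric.ball (0 : EuclideanSpace ℝ (Fin d)) 1) with hω
  have hωt : ω ≠ ∞ := measure_ball_lt_top.ne
  have hinner : ∀ u ∈ Ioi (0 : ℝ), ω * (ENNReal.ofReal (u ^ (α / d)) *
      ∫⁻ z in Ioi (u / stableProfile d α 0),
        ENNReal.ofReal (stableProfileInv d α (u / z) ^ d) ∂lam) =
      ∫⁻ z in Ioi 0, ENNReal.ofReal (u ^ (α / d)) * levelVolume d α (u / z) ∂lam := by
    intro u hu
    have hu0 : 0 < u := hu
    rw [mul_left_comm, ← lintegral_const_mul' _ _ hωt,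
      lintegral_const_mul' _ _ ENNReal.ofReal_ne_top]
    congr 1
    rw [← Ioc_union_Ioi_eq_Ioi (div_pos hu0 hg).le,
      lintegral_union measurableSet_Ioi (Ioc_disjoint_Ioi le_rfl),
      setLIntegral_congr_fun (g := 0) (s := Ioc 0 (u / stableProfile d α 0)) measurableSet_Ioc
        (fun z hz => levelVolume_eq_zero hα0 hα2
          ((le_div_iff₀ hz.1).2 (by rw [mul_comm]; exact (le_div_iff₀ hg).1 hz.2)))]
    simp only [Pi.zero_apply, lintegral_zero, zero_add]
    refine setLIntegral_congr_fun measurableSet_Ioi fun z hz => ?_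
    have hz0 : 0 < z := (div_pos hu0 hg).trans hz
    refine (levelVolume_eq hα0 hα2 (div_pos hu0 hz0) ?_).symm
    rw [div_lt_iff₀ hz0, mul_comm]
    exact (div_lt_iff₀ hg).1 hz
  have hm : Measurable (levelVolume d α) := measurable_levelVolume
  rw [← lintegral_const_mul' _ _ hωt, setLIntegral_congr_fun measurableSet_Ioi hinner,
    lintegral_lintegral_swap (by
      refine Measurable.aemeasurable ?_
      simp only [Function.uncurry_def]
      fun_prop),
    ← lintegral_const_mul' _ _ (truncatedMoment_profile_ne_top hα0 hα2)]
  refine setLIntegral_congr_fun measurableSet_Ioi fun z hz => ?_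
  have hz0 : 0 < z := hz
  have h1 : ∀ u ∈ Ioi (0 : ℝ), ENNReal.ofReal (u ^ (α / d)) * levelVolume d α (u / z) =
      ENNReal.ofReal (z ^ (α / d)) *
        (ENNReal.ofReal ((u / z) ^ (α / d)) * levelVolume d α (u / z)) := fun u hu => by
    have hu0 : 0 < u := hu
    rw [← mul_assoc, ← ENNReal.ofReal_mul (by positivity),
      ← Real.mul_rpow hz0.le (by positivity), mul_div_cancel₀ _ hz0.ne']
  rw [setLIntegral_congr_fun measurableSet_Ioi h1, lintegral_const_mul' _ _ ENNReal.ofReal_ne_top,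
    lintegral_Ioi_comp_div (f := fun v => ENNReal.ofReal (v ^ (α / d)) * levelVolume d α v) hz0,
    lintegral_Ioi_levelVolume hα0 hα2, ← mul_assoc, ← ENNReal.ofReal_mul (by positivity), mul_comm]
  congr 3
  rw [Real.rpow_add hz0, Real.rpow_one, mul_comm]

lemma etaTail_eq_mul (hα0 : 0 < α) (hα2 : α < 2) {t : ℝ} (ht : 0 < t) {lam : Measure ℝ}
    (hlam : IsLevyMeasureOnPos lam) {r : ℝ} (hr : 0 < r) :
    etaTail d α t lam r = ENNReal.ofReal (α / d) * ENNReal.ofReal (1 / r ^ (1 + α / d)) *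
      ∫⁻ z in Ioi 0, ENNReal.ofReal (z ^ (1 + α / d)) *
        truncatedMoment d α (t ^ ((d : ℝ) / α) * (r / z)) ∂lam := by
  rw [etaTail_eq hα0 hα2 ht hlam hr, ← lintegral_const_mul' _ _
    (ENNReal.mul_ne_top ENNReal.ofReal_ne_top ENNReal.ofReal_ne_top)]
  refine setLIntegral_congr_fun measurableSet_Ioi fun z hz => ?_
  have hz0 : 0 < z := hz
  rw [← mul_assoc, ← ENNReal.ofReal_mul (by positivity), ← ENNReal.ofReal_mul (by positivity)]
  congr 2
  rw [Real.rpow_neg (by positivity), Real.div_rpow hr.le hz0.le]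
  field_simp

/-- Dominated convergence in `etaTail_eq_mul`. The limit must be neither `0` nor `∞` for the
quotient to tend to `1`; nontriviality of `lam` excludes `0`. -/
lemma asympEquiv_etaTail (hα0 : 0 < α) (hα2 : α < 2) {t : ℝ} (ht : 0 < t) {lam : Measure ℝ}
    (hlam : IsLevyMeasureOnPos lam)
    (hfin : ∫⁻ z in Ioi 0, ENNReal.ofReal (z ^ (1 + α / d)) ∂lam ≠ ∞) :
    AsympEquiv (etaTail d α t lam) (fun r =>
        ENNReal.ofReal (α / d) *
          volume (Metric.ball (0 : EuclideanSpace ℝ (Fin d)) 1) *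
          ENNReal.ofReal (1 / r ^ (1 + α / d)) *
          ∫⁻ u in Ioi (0 : ℝ), ENNReal.ofReal (u ^ (α / d)) *
            ∫⁻ z in Ioi (u / stableProfile d α 0),
              ENNReal.ofReal (stableProfileInv d α (u / z) ^ d) ∂lam) := by
  have hσ := hlam.sigmaFinite
  have hd : (0 : ℝ) < d := by exact_mod_cast NeZero.pos d
  set K := truncatedMoment d α (stableProfile d α 0) with hK
  set M := ∫⁻ z in Ioi 0, ENNReal.ofReal (z ^ (1 + α / d)) ∂lam with hM
  have hKt : K ≠ ∞ := truncatedMoment_profile_ne_top hα0 hα2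
  have hK0 : K ≠ 0 := (truncatedMoment_pos hα0 hα2 (stableProfile_pos hα0 hα2 le_rfl)).ne'
  have hM0 : M ≠ 0 := by
    rw [hM, hlam.restrict_Ioi]
    intro h0
    rw [lintegral_eq_zero_iff (by fun_prop)] at h0
    have hpos : ∀ᵐ z ∂lam, z ∈ Ioi (0 : ℝ) := by
      rw [← hlam.restrict_Ioi]; exact ae_restrict_mem measurableSet_Ioi
    have hfalse : ∀ᵐ z ∂lam, False := by
      filter_upwards [h0, hpos] with z hz hz0
      have hz1 : 0 < z := hz0
      exact (ENNReal.ofReal_pos.2 (by positivity : 0 < z ^ (1 + α / d))).ne' hz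
    rw [eventually_false_iff_eq_bot, ae_eq_bot] at hfalse
    exact hlam.nontrivial hfalse
  have hKM0 : K * M ≠ 0 := mul_ne_zero hK0 hM0
  have hKMt : K * M ≠ ∞ := ENNReal.mul_ne_top hKt hfin
  set N : ℝ → ℝ≥0∞ := fun r => ∫⁻ z in Ioi 0, ENNReal.ofReal (z ^ (1 + α / d)) *
        truncatedMoment d α (t ^ ((d : ℝ) / α) * (r / z)) ∂lam with hN
  have hNt : Tendsto N atTop (𝓝 (K * M)) := by
    rw [hM, ← lintegral_const_mul' _ _ hKt]
    refine tendsto_lintegral_filter_of_dominated_convergence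
      (fun z => K * ENNReal.ofReal (z ^ (1 + α / d))) (.of_forall fun r => ?_)
      (.of_forall fun r => ae_of_all _ fun z => ?_) ?_ ?_
    · have hm : Measurable (truncatedMoment d α) := truncatedMoment_mono.measurable
      fun_prop
    · rw [mul_comm]
      gcongr
      exact truncatedMoment_le_const hα0 hα2 _
    · rwa [lintegral_const_mul' _ _ hKt]
    · filter_upwards [ae_restrict_mem measurableSet_Ioi] with z hz
      have hz0 : 0 < z := hz
      -- For fixed `z` the integrand is eventually constant in `r`, since the truncation level
      -- passes `g(0)`.
      refine tendsto_const_nhds.congr' ?_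
      have hT : Tendsto (fun r : ℝ => t ^ ((d : ℝ) / α) * (r / z)) atTop atTop :=
        (tendsto_id.atTop_div_const hz0).const_mul_atTop (by positivity)
      filter_upwards [hT.eventually_ge_atTop (stableProfile d α 0)] with r hr
      rw [truncatedMoment_eq_const hα0 hα2 hr, mul_comm]
  have hdiv : Tendsto (fun r => N r / (K * M)) atTop (𝓝 1) := by
    have := ENNReal.Tendsto.div_const hNt (b := K * M) (Or.inr hKM0)
    rwa [ENNReal.div_self hKM0 hKMt] at this
  refine hdiv.congr' ?_
  filter_upwards [eventually_gt_atTop 0] with r hr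
  have hA0 : ENNReal.ofReal (α / d) * ENNReal.ofReal (1 / r ^ (1 + α / d)) ≠ 0 :=
    mul_ne_zero (ENNReal.ofReal_pos.2 (by positivity)).ne'
      (ENNReal.ofReal_pos.2 (by positivity)).ne'
  have hAt : ENNReal.ofReal (α / d) * ENNReal.ofReal (1 / r ^ (1 + α / d)) ≠ ∞ :=
    ENNReal.mul_ne_top ENNReal.ofReal_ne_top ENNReal.ofReal_ne_top
  rw [etaTail_eq_mul hα0 hα2 ht hlam hr, mul_right_comm (ENNReal.ofReal (α / d)) (volume _),
    mul_assoc (_ * _) (volume _), lintegral_stableProfileInv_eq hα0 hα2,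
    ENNReal.mul_div_mul_left _ _ hA0 hAt]

end Moment

/-! ### Domination near infinity -/

/-- `f` is bounded by a constant multiple of `h` near infinity. -/
def Dominated (f h : ℝ → ℝ≥0∞) : Prop := ∃ c : ℝ≥0, ∀ᶠ r in atTop, f r ≤ c * h r

lemma Dominated.of_eventually_le {f h : ℝ → ℝ≥0∞} (H : ∀ᶠ r in atTop, f r ≤ h r) :
    Dominated f h := ⟨1, by simpa using H⟩

lemma Dominated.trans {f g h : ℝ → ℝ≥0∞} (h₁ : Dominated f g) (h₂ : Dominated g h) :
    Dominated f h := by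
  obtain ⟨c₁, h₁⟩ := h₁
  obtain ⟨c₂, h₂⟩ := h₂
  refine ⟨c₁ * c₂, ?_⟩
  filter_upwards [h₁, h₂] with r hr₁ hr₂
  calc f r ≤ c₁ * g r := hr₁
    _ ≤ c₁ * (c₂ * h r) := by gcongr
    _ = _ := by rw [ENNReal.coe_mul, mul_assoc]

lemma Dominated.add {f g h : ℝ → ℝ≥0∞} (h₁ : Dominated f h) (h₂ : Dominated g h) :
    Dominated (fun r => f r + g r) h := by
  obtain ⟨c₁, h₁⟩ := h₁
  obtain ⟨c₂, h₂⟩ := h₂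
  refine ⟨c₁ + c₂, ?_⟩
  filter_upwards [h₁, h₂] with r hr₁ hr₂
  calc f r + g r ≤ c₁ * h r + c₂ * h r := add_le_add hr₁ hr₂
    _ = _ := by rw [ENNReal.coe_add, add_mul]

lemma Dominated.comparable {f h : ℝ → ℝ≥0∞} (h₁ : Dominated f h) (h₂ : Dominated h f) :
    Comparable atTop f h := by
  obtain ⟨c₁, h₁⟩ := h₁
  obtain ⟨c₂, h₂⟩ := h₂
  refine ⟨max 1 (max c₁ c₂), le_max_left _ _, ?_⟩
  have hc0 : ((max 1 (max c₁ c₂) : ℝ≥0) : ℝ≥0∞) ≠ 0 := by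
    have : (0 : ℝ≥0) < max 1 (max c₁ c₂) := lt_max_of_lt_left one_pos
    exact_mod_cast this.ne'
  filter_upwards [h₁, h₂] with r hr₁ hr₂
  constructor
  · rw [ENNReal.inv_mul_le_iff hc0 ENNReal.coe_ne_top]
    refine hr₁.trans ?_
    gcongr
    exact (le_max_left _ _).trans (le_max_right _ _)
  · refine hr₂.trans ?_
    gcongr
    exact (le_max_right _ _).trans (le_max_right _ _)

/-! ### Layer-cake formulas -/

section LayerCake

variable {lam : Measure ℝ}

/-- The level set `{min z r > u}` is `{z > u}` for `u < r` and empty for `u ≥ r`. -/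
lemma lintegral_min_rpow (hlam : IsLevyMeasureOnPos lam) {p r : ℝ} (hp : 0 < p) (hr : 0 < r) :
    ∫⁻ z in Ioi 0, ENNReal.ofReal ((min z r) ^ p) ∂lam =
      ENNReal.ofReal p * ∫⁻ u in Ioc 0 r, lamTail lam u * ENNReal.ofReal (u ^ (p - 1)) := by
  have hnn : 0 ≤ᵐ[lam.restrict (Ioi 0)] fun z => min z r := by
    filter_upwards [ae_restrict_mem measurableSet_Ioi] with z hz
    exact le_min (le_of_lt hz) hr.le
  rw [lintegral_rpow_eq_lintegral_meas_lt_mul _ hnn (by fun_prop) hp]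
  congr 1
  rw [← Ioo_union_Ici_eq_Ioi hr, lintegral_union measurableSet_Ici
    ((Iio_disjoint_Ici le_rfl).mono_left Ioo_subset_Iio_self), Ioo_union_Ici_eq_Ioi hr,
    setLIntegral_congr_fun (g := 0) (s := Ici r) measurableSet_Ici, restrict_Ioo_eq_restrict_Ioc]
  · simp only [Pi.zero_apply, lintegral_zero, add_zero]
    rw [← restrict_Ioo_eq_restrict_Ioc]
    refine setLIntegral_congr_fun measurableSet_Ioo fun u hu => ?_
    rw [hlam.restrict_Ioi, lamTail]
    congr 2
    ext z
    simp [hu.2]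
  · intro u hu
    dsimp only
    have h0 : {a : ℝ | u < min a r} = ∅ :=
      eq_empty_of_forall_notMem fun z hz => absurd (hz.trans_le (min_le_right z r)) (not_lt.2 hu)
    rw [h0, measure_empty, zero_mul, Pi.zero_apply]

/-- For levels `u ≤ r` the restricted measure has constant tail `λ̄(r)`, whence the boundary term.
-/
lemma lintegral_Ioi_rpow (hlam : IsLevyMeasureOnPos lam) {q r : ℝ} (hq : 0 < q) (hr : 0 < r) :
    ∫⁻ z in Ioi r, ENNReal.ofReal (z ^ q) ∂lam =
      lamTail lam r * ENNReal.ofReal (r ^ q) +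
      ENNReal.ofReal q * ∫⁻ u in Ioi r, lamTail lam u * ENNReal.ofReal (u ^ (q - 1)) := by
  have hnn : 0 ≤ᵐ[lam.restrict (Ioi r)] fun z => z := by
    filter_upwards [ae_restrict_mem measurableSet_Ioi] with z hz
    exact (hr.trans hz).le
  rw [lintegral_rpow_eq_lintegral_meas_lt_mul _ hnn (by fun_prop) hq,
    ← Ioc_union_Ioi_eq_Ioi hr.le, lintegral_union measurableSet_Ioi (Ioc_disjoint_Ioi le_rfl),
    mul_add]
  congr 1
  · have h1 : ∀ u ∈ Ioc 0 r, (lam.restrict (Ioi r)) {a | u < a} * ENNReal.ofReal (u ^ (q - 1)) =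
        lamTail lam r * ENNReal.ofReal (u ^ (q - 1)) := fun u hu => by
      change (lam.restrict (Ioi r)) (Ioi u) * _ = _
      rw [Measure.restrict_apply measurableSet_Ioi,
        inter_eq_self_of_subset_right (Ioi_subset_Ioi hu.2), lamTail]
    rw [setLIntegral_congr_fun measurableSet_Ioc h1,
      lintegral_const_mul' (lamTail lam r) _ (hlam.measure_Ioi_lt_top hr).ne,
      lintegral_Ioc_zero_rpow (by linarith) hr.le, mul_left_comm, ← ENNReal.ofReal_mul hq.le,
      sub_add_cancel, mul_div_cancel₀ _ hq.ne']
  · congr 1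
    refine setLIntegral_congr_fun measurableSet_Ioi fun u hu => ?_
    change (lam.restrict (Ioi r)) (Ioi u) * _ = _
    rw [Measure.restrict_apply measurableSet_Ioi,
      inter_eq_self_of_subset_left (Ioi_subset_Ioi (le_of_lt hu)), lamTail]

end LayerCake

/-! ### Two-sided bounds for `η̄` by truncated moments of `λ` -/

section Bounds

variable {d : ℕ} [NeZero d] {α : ℝ}

/-- For `z ≤ r` the truncated moment is bounded by its total; for `z > r` its power bound at
`t^{d/α} r/z` converts `z^p r^{-p}` into `z^q r^{-q}`. -/
lemma etaTail_le (hα0 : 0 < α) (hα2 : α < 2) {t : ℝ} (ht : 0 < t) {lam : Measure ℝ}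
    (hlam : IsLevyMeasureOnPos lam) : ∃ C : ℝ≥0, ∀ r, 0 < r → etaTail d α t lam r ≤ C *
      (ENNReal.ofReal (1 / r ^ (1 + α / d)) * ∫⁻ z in Ioc 0 r, ENNReal.ofReal (z ^ (1 + α / d)) ∂lam +
      ENNReal.ofReal (1 / r ^ ((d : ℝ) / (d + α))) *
        ∫⁻ z in Ioi r, ENNReal.ofReal (z ^ ((d : ℝ) / (d + α))) ∂lam) := by
  obtain ⟨C, hC⟩ := truncatedMoment_le (d := d) hα0 hα2
  set K := truncatedMoment d α (stableProfile d α 0) with hK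
  have hKt : K ≠ ∞ := truncatedMoment_profile_ne_top hα0 hα2
  set p := 1 + α / d with hp
  set q := (d : ℝ) / (d + α) with hq
  set T := t ^ ((d : ℝ) / α) with hT
  have hT0 : 0 < T := by positivity
  set D : ℝ≥0 := max K.toNNReal (C * (T ^ (p - q)).toNNReal) with hD
  refine ⟨(α / d).toNNReal * D, fun r hr => ?_⟩
  rw [etaTail_eq_mul hα0 hα2 ht hlam hr, ← Ioc_union_Ioi_eq_Ioi hr.le,
    lintegral_union measurableSet_Ioi (Ioc_disjoint_Ioi le_rfl), mul_add, mul_add]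
  refine add_le_add ?_ ?_
  · have h1 : ∫⁻ z in Ioc 0 r, ENNReal.ofReal (z ^ p) * truncatedMoment d α (T * (r / z)) ∂lam ≤
        D * ∫⁻ z in Ioc 0 r, ENNReal.ofReal (z ^ p) ∂lam := by
      rw [← lintegral_const_mul' _ _ ENNReal.coe_ne_top]
      refine lintegral_mono fun z => ?_
      rw [mul_comm]
      gcongr
      calc _ ≤ K := truncatedMoment_le_const hα0 hα2 _
        _ = K.toNNReal := (ENNReal.coe_toNNReal hKt).symm
        _ ≤ _ := by exact_mod_cast le_max_left _ _
    calc _ ≤ ENNReal.ofReal (α / d) * ENNReal.ofReal (1 / r ^ p) *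
          (D * ∫⁻ z in Ioc 0 r, ENNReal.ofReal (z ^ p) ∂lam) := by gcongr
      _ = _ := by rw [ENNReal.coe_mul, ENNReal.ofReal]; ring
  · have h1 : ENNReal.ofReal (1 / r ^ p) *
        ∫⁻ z in Ioi r, ENNReal.ofReal (z ^ p) * truncatedMoment d α (T * (r / z)) ∂lam ≤
        D * (ENNReal.ofReal (1 / r ^ q) * ∫⁻ z in Ioi r, ENNReal.ofReal (z ^ q) ∂lam) := by
      rw [← lintegral_const_mul' _ _ ENNReal.ofReal_ne_top,
        ← lintegral_const_mul' _ _ ENNReal.ofReal_ne_top,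
        ← lintegral_const_mul' _ _ ENNReal.coe_ne_top]
      refine setLIntegral_mono' measurableSet_Ioi fun z hz => ?_
      have hz0 : 0 < z := hr.trans hz
      calc _ ≤ ENNReal.ofReal (1 / r ^ p) * (ENNReal.ofReal (z ^ p) *
            (C * ENNReal.ofReal ((T * (r / z)) ^ (p - q)))) := by
            gcongr; exact hC _ (by positivity)
        _ = C * ENNReal.ofReal (T ^ (p - q)) *
            (ENNReal.ofReal (1 / r ^ q) * ENNReal.ofReal (z ^ q)) := by
            rw [mul_left_comm _ (C : ℝ≥0∞), mul_left_comm _ (C : ℝ≥0∞), mul_assoc (C : ℝ≥0∞)]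
            congr 1
            rw [← ENNReal.ofReal_mul (by positivity), ← ENNReal.ofReal_mul (by positivity),
              ← ENNReal.ofReal_mul (by positivity), ← ENNReal.ofReal_mul (by positivity)]
            congr 1
            rw [Real.mul_rpow hT0.le (by positivity), Real.div_rpow hr.le hz0.le,
              Real.rpow_sub hr, Real.rpow_sub hz0]
            field_simp
        _ ≤ _ := by
            gcongr
            rw [ENNReal.ofReal, ← ENNReal.coe_mul]
            exact_mod_cast le_max_right _ _
    calc _ = ENNReal.ofReal (α / d) * (ENNReal.ofReal (1 / r ^ p) *
          ∫⁻ z in Ioi r, ENNReal.ofReal (z ^ p) * truncatedMoment d α (T * (r / z)) ∂lam) := by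
            rw [mul_assoc]
      _ ≤ ENNReal.ofReal (α / d) *
          (D * (ENNReal.ofReal (1 / r ^ q) * ∫⁻ z in Ioi r, ENNReal.ofReal (z ^ q) ∂lam)) := by
            gcongr
      _ = _ := by rw [ENNReal.coe_mul, ENNReal.ofReal]; ring

/-- Monotonicity carries the bound from `(0, v₀]` to `(0, X]`: evaluate it at `min 1 (v₀/X) * x`,
losing only a constant. -/
lemma le_truncatedMoment_of_le (hα0 : 0 < α) (hα2 : α < 2) {X : ℝ} (hX : 0 < X) :
    ∃ c : ℝ≥0, 0 < c ∧ ∀ x, 0 ≤ x → x ≤ X →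
    c * ENNReal.ofReal (x ^ (1 + α / d - (d : ℝ) / (d + α))) ≤ truncatedMoment d α x := by
  obtain ⟨c, hc, v₀, hv₀, h⟩ := le_truncatedMoment (d := d) hα0 hα2
  have he : 0 < 1 + α / d - (d : ℝ) / (d + α) := by
    have := exponent_pos (d := d) hα0; linarith
  set e := 1 + α / d - (d : ℝ) / (d + α)
  have hk : 0 < min 1 (v₀ / X) := lt_min one_pos (by positivity)
  refine ⟨c * ((min 1 (v₀ / X)) ^ e).toNNReal,
    mul_pos hc (Real.toNNReal_pos.2 (by positivity)), fun x hx hxX => ?_⟩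
  have hy0 : 0 ≤ min 1 (v₀ / X) * x := by positivity
  have hy1 : min 1 (v₀ / X) * x ≤ v₀ := by
    calc _ ≤ (v₀ / X) * X := by gcongr; exact min_le_right _ _
      _ = v₀ := by field_simp
  have hy2 : min 1 (v₀ / X) * x ≤ x := mul_le_of_le_one_left hx (min_le_left _ _)
  refine le_trans (le_of_eq ?_) ((h _ hy0 hy1).trans (truncatedMoment_mono hy2))
  rw [Real.mul_rpow hk.le hx, ENNReal.ofReal_mul (by positivity), ENNReal.coe_mul, mul_assoc]
  rfl

/-- The split at `z = r` again: the argument of the truncated moment is at least `T = t^{d/α}` for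
`z ≤ r`, so monotonicity applies, and at most `T` for `z > r`, where the power lower bound holds. -/
lemma le_etaTail (hα0 : 0 < α) (hα2 : α < 2) {t : ℝ} (ht : 0 < t) {lam : Measure ℝ}
    (hlam : IsLevyMeasureOnPos lam) : ∃ C : ℝ≥0, ∀ r, 0 < r →
      (ENNReal.ofReal (1 / r ^ (1 + α / d)) * ∫⁻ z in Ioc 0 r, ENNReal.ofReal (z ^ (1 + α / d)) ∂lam +
      ENNReal.ofReal (1 / r ^ ((d : ℝ) / (d + α))) *
        ∫⁻ z in Ioi r, ENNReal.ofReal (z ^ ((d : ℝ) / (d + α))) ∂lam) ≤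
      C * etaTail d α t lam r := by
  have hd : (0 : ℝ) < d := by exact_mod_cast NeZero.pos d
  have he : 0 < 1 + α / d - (d : ℝ) / (d + α) := by
    have := exponent_pos (d := d) hα0; linarith
  set p := 1 + α / d with hp
  set q := (d : ℝ) / (d + α) with hq
  set T := t ^ ((d : ℝ) / α) with hT
  have hT0 : 0 < T := by positivity
  obtain ⟨c, hc, h⟩ := le_truncatedMoment_of_le (d := d) hα0 hα2 hT0
  set D : ℝ≥0 := c * (T ^ (p - q)).toNNReal with hD
  have hD0 : 0 < D := mul_pos hc (Real.toNNReal_pos.2 (by positivity))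
  set A : ℝ≥0 := (α / d).toNNReal * D with hA
  have hofReal : ENNReal.ofReal (α / d) = ((α / d).toNNReal : ℝ≥0∞) := rfl
  have hA0 : 0 < A := mul_pos (Real.toNNReal_pos.2 (by positivity)) hD0
  suffices hs : ∀ r, 0 < r → (A : ℝ≥0∞) *
      (ENNReal.ofReal (1 / r ^ p) * ∫⁻ z in Ioc 0 r, ENNReal.ofReal (z ^ p) ∂lam +
      ENNReal.ofReal (1 / r ^ q) * ∫⁻ z in Ioi r, ENNReal.ofReal (z ^ q) ∂lam) ≤
      etaTail d α t lam r by
    refine ⟨A⁻¹, fun r hr => ?_⟩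
    rw [ENNReal.coe_inv hA0.ne', ← ENNReal.div_eq_inv_mul, ENNReal.le_div_iff_mul_le
      (Or.inl (by exact_mod_cast hA0.ne')) (Or.inl ENNReal.coe_ne_top), mul_comm]
    exact hs r hr
  intro r hr
  rw [etaTail_eq_mul hα0 hα2 ht hlam hr, ← Ioc_union_Ioi_eq_Ioi hr.le,
    lintegral_union measurableSet_Ioi (Ioc_disjoint_Ioi le_rfl), mul_add, mul_add]
  refine add_le_add ?_ ?_
  · have h1 : D * ∫⁻ z in Ioc 0 r, ENNReal.ofReal (z ^ p) ∂lam ≤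
        ∫⁻ z in Ioc 0 r, ENNReal.ofReal (z ^ p) * truncatedMoment d α (T * (r / z)) ∂lam := by
      rw [← lintegral_const_mul' _ _ ENNReal.coe_ne_top]
      refine setLIntegral_mono' measurableSet_Ioc fun z hz => ?_
      rw [mul_comm]
      gcongr
      calc (D : ℝ≥0∞) = c * ENNReal.ofReal (T ^ (p - q)) := by rw [hD, ENNReal.coe_mul]; rfl
        _ ≤ truncatedMoment d α T := h T hT0.le le_rfl
        _ ≤ _ := truncatedMoment_mono
            (le_mul_of_one_le_right hT0.le ((one_le_div hz.1).2 hz.2))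
    calc _ = ENNReal.ofReal (α / d) * ENNReal.ofReal (1 / r ^ p) *
          (D * ∫⁻ z in Ioc 0 r, ENNReal.ofReal (z ^ p) ∂lam) := by
            rw [hA, ENNReal.coe_mul, ← hofReal]; ring
      _ ≤ _ := by gcongr
  · have h1 : D * (ENNReal.ofReal (1 / r ^ q) * ∫⁻ z in Ioi r, ENNReal.ofReal (z ^ q) ∂lam) ≤
        ENNReal.ofReal (1 / r ^ p) *
        ∫⁻ z in Ioi r, ENNReal.ofReal (z ^ p) * truncatedMoment d α (T * (r / z)) ∂lam := by
      rw [← lintegral_const_mul' _ _ ENNReal.ofReal_ne_top,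
        ← lintegral_const_mul' _ _ ENNReal.ofReal_ne_top,
        ← lintegral_const_mul' _ _ ENNReal.coe_ne_top]
      refine setLIntegral_mono' measurableSet_Ioi fun z hz => ?_
      have hz0 : 0 < z := hr.trans hz
      have hz1 : r ≤ z := le_of_lt hz
      calc _ = ENNReal.ofReal (1 / r ^ p) * (ENNReal.ofReal (z ^ p) *
            (c * ENNReal.ofReal ((T * (r / z)) ^ (p - q)))) := by
            rw [mul_left_comm _ (c : ℝ≥0∞), mul_left_comm _ (c : ℝ≥0∞), hD, ENNReal.coe_mul,
              mul_assoc (c : ℝ≥0∞)]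
            congr 1
            rw [← ENNReal.ofReal, ← ENNReal.ofReal_mul (by positivity),
              ← ENNReal.ofReal_mul (by positivity),
              ← ENNReal.ofReal_mul (by positivity), ← ENNReal.ofReal_mul (by positivity)]
            congr 1
            rw [Real.mul_rpow hT0.le (by positivity), Real.div_rpow hr.le hz0.le,
              Real.rpow_sub hr, Real.rpow_sub hz0]
            field_simp
        _ ≤ _ := by
            gcongr
            exact h _ (by positivity)
              (mul_le_of_le_one_right hT0.le ((div_le_one hz0).2 hz1))
    calc _ = ENNReal.ofReal (α / d) *
          (D * (ENNReal.ofReal (1 / r ^ q) * ∫⁻ z in Ioi r, ENNReal.ofReal (z ^ q) ∂lam)) := by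
            rw [hA, ENNReal.coe_mul, ← hofReal]; ring
      _ ≤ ENNReal.ofReal (α / d) * (ENNReal.ofReal (1 / r ^ p) *
          ∫⁻ z in Ioi r, ENNReal.ofReal (z ^ p) * truncatedMoment d α (T * (r / z)) ∂lam) := by
            gcongr
      _ = _ := by rw [mul_assoc]

end Bounds

/-! ### Reduction to means of the tail of `λ` -/

/-- `r ↦ r ^ (-p) ∫ u ^ (p-1) λ((u, ∞)) du` over `(0, r]`. -/
def lowerTailMean (lam : Measure ℝ) (p r : ℝ) : ℝ≥0∞ :=
  ENNReal.ofReal (1 / r ^ p) * ∫⁻ u in Ioc 0 r, lamTail lam u * ENNReal.ofReal (u ^ (p - 1))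

/-- `r ↦ r ^ (-q) ∫ u ^ (q-1) λ((u, ∞)) du` over `(r, ∞)`. -/
def upperTailMean (lam : Measure ℝ) (q r : ℝ) : ℝ≥0∞ :=
  ENNReal.ofReal (1 / r ^ q) * ∫⁻ u in Ioi r, lamTail lam u * ENNReal.ofReal (u ^ (q - 1))

lemma ofReal_one_div_rpow_mul {r : ℝ} (hr : 0 < r) (e : ℝ) :
    ENNReal.ofReal (1 / r ^ e) * ENNReal.ofReal (r ^ e) = 1 := by
  have : r ^ e ≠ 0 := by positivity
  rw [← ENNReal.ofReal_mul (by positivity), one_div_mul_cancel this, ENNReal.ofReal_one]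

lemma Dominated.of_const_mul {f h : ℝ → ℝ≥0∞} {c : ℝ≥0∞} (hc0 : c ≠ 0) (hct : c ≠ ∞)
    (H : Dominated (fun r => c * f r) h) : Dominated f h := by
  refine Dominated.trans (g := fun r => c * f r) ⟨c⁻¹.toNNReal, .of_forall fun r => ?_⟩ H
  rw [ENNReal.coe_toNNReal (ENNReal.inv_ne_top.2 hc0), ← mul_assoc,
    ENNReal.inv_mul_cancel hc0 hct, one_mul]

lemma Dominated.const_mul {f : ℝ → ℝ≥0∞} {c : ℝ≥0∞} (hct : c ≠ ∞) :
    Dominated (fun r => c * f r) f :=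
  ⟨c.toNNReal, .of_forall fun r => by rw [ENNReal.coe_toNNReal hct]⟩

section TailMeans

variable {lam : Measure ℝ} {p q r : ℝ}

lemma ofReal_mul_upperTailMean (hlam : IsLevyMeasureOnPos lam) (hq : 0 < q) (hr : 0 < r) :
    lamTail lam r + ENNReal.ofReal q * upperTailMean lam q r =
      ENNReal.ofReal (1 / r ^ q) * ∫⁻ z in Ioi r, ENNReal.ofReal (z ^ q) ∂lam := by
  rw [lintegral_Ioi_rpow hlam hq hr, mul_add, mul_left_comm _ (lamTail lam r),
    ofReal_one_div_rpow_mul hr, mul_one, upperTailMean, mul_left_comm]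

lemma ofReal_mul_lowerTailMean (hlam : IsLevyMeasureOnPos lam) (hp : 0 < p) (hr : 0 < r) :
    ENNReal.ofReal p * lowerTailMean lam p r =
      ENNReal.ofReal (1 / r ^ p) * ∫⁻ z in Ioc 0 r, ENNReal.ofReal (z ^ p) ∂lam +
        lamTail lam r := by
  rw [lowerTailMean, mul_left_comm, ← lintegral_min_rpow hlam hp hr, ← Ioc_union_Ioi_eq_Ioi hr.le,
    lintegral_union measurableSet_Ioi (Ioc_disjoint_Ioi le_rfl), mul_add]
  congr 1
  · congr 1
    refine setLIntegral_congr_fun measurableSet_Ioc fun z hz => ?_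
    rw [min_eq_left hz.2]
  · have h1 : ∀ z ∈ Ioi r, ENNReal.ofReal ((min z r) ^ p) = ENNReal.ofReal (r ^ p) :=
      fun z hz => by rw [min_eq_right (le_of_lt hz)]
    rw [setLIntegral_congr_fun measurableSet_Ioi h1, setLIntegral_const, ← mul_assoc,
      ofReal_one_div_rpow_mul hr, one_mul, lamTail]

lemma lintegral_Ioc_lamTail_lt_top (hlam : IsLevyMeasureOnPos lam) (hp : 0 < p)
    (hsmall : ∫⁻ z in Ioc (0 : ℝ) 1, ENNReal.ofReal (z ^ p) ∂lam < ∞) (hr : 0 < r) :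
    ∫⁻ u in Ioc 0 r, lamTail lam u * ENNReal.ofReal (u ^ (p - 1)) < ∞ := by
  have h1 : ∫⁻ z in Ioi 0, ENNReal.ofReal ((min z r) ^ p) ∂lam < ∞ := by
    rw [← Ioc_union_Ioi_eq_Ioi (zero_le_one' ℝ), lintegral_union measurableSet_Ioi
      (Ioc_disjoint_Ioi le_rfl)]
    refine ENNReal.add_lt_top.2 ⟨lt_of_le_of_lt ?_ hsmall, ?_⟩
    · refine setLIntegral_mono' measurableSet_Ioc fun z hz => ENNReal.ofReal_le_ofReal ?_
      exact Real.rpow_le_rpow (le_min hz.1.le hr.le) (min_le_left _ _) hp.le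
    · calc _ ≤ ∫⁻ _ in Ioi 1, ENNReal.ofReal (r ^ p) ∂lam := by
            refine setLIntegral_mono' measurableSet_Ioi fun z hz => ENNReal.ofReal_le_ofReal ?_
            have : (0 : ℝ) < z := one_pos.trans hz
            exact Real.rpow_le_rpow (le_min this.le hr.le) (min_le_right _ _) hp.le
        _ < ∞ := by
            rw [setLIntegral_const]
            exact ENNReal.mul_lt_top ENNReal.ofReal_lt_top (hlam.measure_Ioi_lt_top one_pos)
  rw [lintegral_min_rpow hlam hp hr] at h1
  exact ENNReal.lt_top_of_mul_ne_top_right h1.ne (ENNReal.ofReal_pos.2 hp).ne'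

end TailMeans

section EtaTail

variable {d : ℕ} [NeZero d] {α : ℝ} {t : ℝ} {lam : Measure ℝ}

/-- With `dominated_etaTail`, this says that `η̄` is comparable to the sum of the lower mean, `λ̄`
and the upper mean; each term can then be estimated separately. -/
lemma etaTail_dominated (hα0 : 0 < α) (hα2 : α < 2) (ht : 0 < t) (hlam : IsLevyMeasureOnPos lam)
    {h : ℝ → ℝ≥0∞} (h₁ : Dominated (lowerTailMean lam (1 + α / d)) h)
    (h₂ : Dominated (lamTail lam) h)
    (h₃ : Dominated (upperTailMean lam ((d : ℝ) / (d + α))) h) :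
    Dominated (etaTail d α t lam) h := by
  have hd : (0 : ℝ) < d := by exact_mod_cast NeZero.pos d
  obtain ⟨C, hC⟩ := etaTail_le (d := d) hα0 hα2 ht hlam
  refine Dominated.trans ⟨C, ?_⟩ ((Dominated.const_mul (ENNReal.ofReal_ne_top
    (r := 1 + α / d))).trans h₁ |>.add (h₂.add ((Dominated.const_mul (ENNReal.ofReal_ne_top
      (r := (d : ℝ) / (d + α)))).trans h₃)))
  filter_upwards [eventually_gt_atTop 0] with r hr
  refine (hC r hr).trans ?_
  rw [ofReal_mul_upperTailMean hlam (by positivity) hr,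
    ofReal_mul_lowerTailMean hlam (by positivity) hr]
  gcongr
  exact le_self_add

lemma dominated_etaTail (hα0 : 0 < α) (hα2 : α < 2) (ht : 0 < t) (hlam : IsLevyMeasureOnPos lam) :
    Dominated (lowerTailMean lam (1 + α / d)) (etaTail d α t lam) ∧
    Dominated (lamTail lam) (etaTail d α t lam) ∧
    Dominated (upperTailMean lam ((d : ℝ) / (d + α))) (etaTail d α t lam) := by
  have hd : (0 : ℝ) < d := by exact_mod_cast NeZero.pos d
  have hp : 0 < 1 + α / d := by positivity
  have hq : 0 < (d : ℝ) / (d + α) := by positivity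
  obtain ⟨C, hC⟩ := le_etaTail (d := d) hα0 hα2 ht hlam
  have h₂ : Dominated (lamTail lam) (etaTail d α t lam) := by
    refine ⟨C, ?_⟩
    filter_upwards [eventually_gt_atTop 0] with r hr
    refine le_trans ?_ (hC r hr)
    rw [← ofReal_mul_upperTailMean hlam hq hr]
    exact le_self_add.trans le_add_self
  refine ⟨?_, h₂, ?_⟩
  · refine Dominated.of_const_mul (c := ENNReal.ofReal (1 + α / d)) (ENNReal.ofReal_pos.2 hp).ne'
      ENNReal.ofReal_ne_top ?_
    -- The lower mean carries an extra `λ̄(r)`, which `h₂` absorbs.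
    refine Dominated.trans (g := fun r => ENNReal.ofReal (1 / r ^ (1 + α / d)) *
      ∫⁻ z in Ioc 0 r, ENNReal.ofReal (z ^ (1 + α / d)) ∂lam + lamTail lam r) ?_ (Dominated.add ?_ h₂)
    · refine .of_eventually_le ?_
      filter_upwards [eventually_gt_atTop 0] with r hr
      exact (ofReal_mul_lowerTailMean hlam hp hr).le
    · refine ⟨C, ?_⟩
      filter_upwards [eventually_gt_atTop 0] with r hr
      exact le_self_add.trans (hC r hr)
  · refine Dominated.of_const_mul (c := ENNReal.ofReal ((d : ℝ) / (d + α)))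
      (ENNReal.ofReal_pos.2 hq).ne' ENNReal.ofReal_ne_top ⟨C, ?_⟩
    filter_upwards [eventually_gt_atTop 0] with r hr
    refine le_trans ?_ (hC r hr)
    rw [← ofReal_mul_upperTailMean hlam hq hr]
    exact le_add_self.trans le_add_self

end EtaTail

/-! ### Potter's bounds -/

section Potter

/-- Potter's bounds for a slowly varying function `l` such that `l u / u ^ β` is almost
decreasing. -/
lemma IsSlowlyVarying.potter {l : ℝ → ℝ} (hl : IsSlowlyVarying l) {β M : ℝ} (hβ : 0 ≤ β)
    (hM : 0 < M) (hanti : ∀ r u, 1 ≤ r → r ≤ u → l u / u ^ β ≤ M * (l r / r ^ β)) {δ : ℝ}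
    (hδ : 0 < δ) : ∃ C, 0 < C ∧ ∃ r₀, 1 ≤ r₀ ∧ ∀ r u, r₀ ≤ r → r ≤ u →
      l u ≤ C * (u / r) ^ δ * l r ∧ l r ≤ C * (u / r) ^ δ * l u := by
  have h2δ : (1 : ℝ) < 2 ^ δ := Real.one_lt_rpow one_lt_two hδ
  have ht := hl.tendsto 2 two_pos
  -- Slow variation is used for the factor `2` only. Iteration reaches the points `2^n r`, and the
  -- almost monotonicity `hanti` fills the gaps, so no uniform convergence theorem enters.
  obtain ⟨r₁, hr₁⟩ := eventually_atTop.1 ((ht.eventually_lt_const h2δ).and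
    (ht.eventually_const_lt (inv_lt_one_of_one_lt₀ h2δ)))
  set r₀ := max 1 r₁ with hr₀
  have hstep : ∀ r, r₀ ≤ r → l (2 * r) ≤ 2 ^ δ * l r ∧ l r ≤ 2 ^ δ * l (2 * r) := fun r hr => by
    have hlr := hl.pos r ((le_max_left _ _).trans hr)
    obtain ⟨h1, h2⟩ := hr₁ r ((le_max_right _ _).trans hr)
    refine ⟨((div_lt_iff₀ hlr).1 h1).le, ?_⟩
    have := ((lt_div_iff₀ hlr).1 h2).le
    rwa [inv_mul_le_iff₀ (by positivity)] at this
  have hiter : ∀ n : ℕ, ∀ r, r₀ ≤ r →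
      l (2 ^ n * r) ≤ (2 ^ n) ^ δ * l r ∧ l r ≤ (2 ^ n) ^ δ * l (2 ^ n * r) := by
    intro n
    induction n with
    | zero => intro r _; simp
    | succ n ih =>
      intro r hr
      have hr0 : 0 < r := by linarith [le_max_left 1 r₁]
      have hr' : r₀ ≤ 2 ^ n * r := hr.trans (le_mul_of_one_le_left hr0.le (one_le_pow₀ one_le_two))
      obtain ⟨h1, h2⟩ := ih r hr
      obtain ⟨h3, h4⟩ := hstep _ hr'
      have he : (2 : ℝ) ^ (n + 1) * r = 2 * (2 ^ n * r) := by ring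
      have hp : ((2 : ℝ) ^ (n + 1)) ^ δ = 2 ^ δ * (2 ^ n) ^ δ := by
        rw [pow_succ, Real.mul_rpow (by positivity) zero_le_two, mul_comm]
      rw [he, hp]
      constructor
      · calc _ ≤ _ := h3
          _ ≤ 2 ^ δ * ((2 ^ n) ^ δ * l r) := by gcongr
          _ = _ := by ring
      · calc _ ≤ _ := h2
          _ ≤ (2 ^ n) ^ δ * (2 ^ δ * l (2 * (2 ^ n * r))) := by gcongr
          _ = _ := by ring
  have hanti' : ∀ r u k, 1 ≤ r → r ≤ u → u ≤ k * r → l u ≤ M * k ^ β * l r := by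
    intro r u k hr hu hk
    have hr0 : 0 < r := by linarith
    have hu0 : 0 < u := by linarith
    have h := hanti r u hr hu
    rw [div_le_iff₀ (by positivity)] at h
    have hlr := hl.pos r hr
    calc l u ≤ M * (l r / r ^ β) * u ^ β := h
      _ = M * (u / r) ^ β * l r := by rw [Real.div_rpow hu0.le hr0.le]; ring
      _ ≤ _ := by
        gcongr
        exact (div_le_iff₀ hr0).2 hk
  refine ⟨M * 2 ^ β * 2 ^ δ, by positivity, r₀, le_max_left _ _, fun r u hr hu => ?_⟩
  have hr1 : 1 ≤ r := (le_max_left _ _).trans hr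
  have hr0 : 0 < r := by linarith
  obtain ⟨n, hn1, hn2⟩ := exists_nat_pow_near ((one_le_div hr0).2 hu) (one_lt_two (α := ℝ))
  have hn1' : 2 ^ n * r ≤ u := (le_div_iff₀ hr0).1 hn1
  have hn2' : u ≤ 2 ^ (n + 1) * r := ((div_lt_iff₀ hr0).1 hn2).le
  have h2n : r ≤ 2 ^ n * r := le_mul_of_one_le_left hr0.le (one_le_pow₀ one_le_two)
  have hlr := hl.pos r hr1
  have hlu := hl.pos u (hr1.trans hu)
  have hu0 : 0 < u := hr0.trans_le hu
  constructor
  · calc l u ≤ M * 2 ^ β * l (2 ^ n * r) :=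
          hanti' _ _ _ (hr1.trans h2n) hn1' (by rw [← mul_assoc, ← pow_succ']; exact hn2')
      _ ≤ M * 2 ^ β * ((2 ^ n) ^ δ * l r) := by gcongr; exact (hiter n r hr).1
      _ ≤ M * 2 ^ β * ((u / r) ^ δ * l r) := by gcongr
      _ ≤ M * 2 ^ β * ((u / r) ^ δ * l r) * 2 ^ δ :=
          le_mul_of_one_le_right (by positivity) h2δ.le
      _ = _ := by ring
  -- The hypothesis bounds values of `l` at larger arguments only, so here the chain overshoots to
  -- `2^{n+1} r ≥ u`.
  · have h2u : (2 : ℝ) ^ (n + 1) * r ≤ 2 * u := by rw [pow_succ]; linarith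
    calc l r ≤ (2 ^ (n + 1)) ^ δ * l (2 ^ (n + 1) * r) := (hiter (n + 1) r hr).2
      _ ≤ (2 ^ (n + 1)) ^ δ * (M * 2 ^ β * l u) := by
          gcongr
          exact hanti' _ _ _ (hr1.trans hu) hn2' h2u
      _ = 2 ^ δ * (2 ^ n) ^ δ * (M * 2 ^ β * l u) := by
          rw [pow_succ, Real.mul_rpow (by positivity) zero_le_two]; ring
      _ ≤ 2 ^ δ * (u / r) ^ δ * (M * 2 ^ β * l u) := by gcongr
      _ = _ := by ring

end Potter

/-! ### Karamata-type estimates -/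

lemma lintegral_Ioi_rpow_volume {e r : ℝ} (he : e < -1) (hr : 0 < r) :
    ∫⁻ u in Ioi r, ENNReal.ofReal (u ^ e) = ENNReal.ofReal (-r ^ (e + 1) / (e + 1)) := by
  rw [← ofReal_integral_eq_lintegral_ofReal (integrableOn_Ioi_rpow_of_lt he hr),
    integral_Ioi_rpow_of_lt he hr]
  filter_upwards [ae_restrict_mem measurableSet_Ioi] with v hv
  exact Real.rpow_nonneg (hr.trans hv).le _

section Karamata

variable {lam : Measure ℝ} {l : ℝ → ℝ} {β : ℝ} {c : ℝ≥0}

lemma dominated_lamTail (hle : ∀ r, 1 ≤ r → lamTail lam r ≤ c * ENNReal.ofReal (l r / r ^ β)) :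
    Dominated (lamTail lam) (fun r => ENNReal.ofReal (l r / r ^ β)) :=
  ⟨c, by filter_upwards [eventually_ge_atTop 1] with r hr using hle r hr⟩

/-- `λ̄` is nonincreasing and comparable to `l r / r^β`. The `+ 1` keeps the constant positive. -/
lemma almost_antitone (hl : IsSlowlyVarying l)
    (hle : ∀ r, 1 ≤ r → lamTail lam r ≤ c * ENNReal.ofReal (l r / r ^ β))
    (hge : ∀ r, 1 ≤ r → ENNReal.ofReal (l r / r ^ β) ≤ c * lamTail lam r) :
    ∀ r u, 1 ≤ r → r ≤ u → l u / u ^ β ≤ (c * c + 1) * (l r / r ^ β) := by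
  intro r u hr hu
  have hr0 : 0 < r := by linarith
  have hlr := hl.pos r hr
  have h : ENNReal.ofReal (l u / u ^ β) ≤ ENNReal.ofReal (c * c * (l r / r ^ β)) := by
    calc _ ≤ c * lamTail lam u := hge u (hr.trans hu)
      _ ≤ c * lamTail lam r := by gcongr; exact measure_mono (Ioi_subset_Ioi hu)
      _ ≤ c * (c * ENNReal.ofReal (l r / r ^ β)) := by gcongr; exact hle r hr
      _ = _ := by
        rw [ENNReal.ofReal_mul (by positivity), ENNReal.ofReal_mul (by positivity),
          ENNReal.ofReal_coe_nnreal, mul_assoc]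
  rw [ENNReal.ofReal_le_ofReal_iff (by positivity)] at h
  have : 0 ≤ l r / r ^ β := by positivity
  linarith

lemma lamTail_mul_le (hl : IsSlowlyVarying l)
    (hle : ∀ r, 1 ≤ r → lamTail lam r ≤ c * ENNReal.ofReal (l r / r ^ β)) {u : ℝ} (hu : 1 ≤ u)
    (e : ℝ) : lamTail lam u * ENNReal.ofReal (u ^ e) ≤ c * ENNReal.ofReal (l u * u ^ (e - β)) := by
  have hu0 : 0 < u := by linarith
  have hlu := hl.pos u hu
  calc _ ≤ c * ENNReal.ofReal (l u / u ^ β) * ENNReal.ofReal (u ^ e) := by gcongr; exact hle u hu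
    _ = _ := by
      rw [mul_assoc, ← ENNReal.ofReal_mul (by positivity), Real.rpow_sub hu0]
      congr 2; ring

lemma le_lamTail_mul (hl : IsSlowlyVarying l)
    (hge : ∀ r, 1 ≤ r → ENNReal.ofReal (l r / r ^ β) ≤ c * lamTail lam r) {u : ℝ} (hu : 1 ≤ u)
    (e : ℝ) : ENNReal.ofReal (l u * u ^ (e - β)) ≤ c * (lamTail lam u * ENNReal.ofReal (u ^ e)) := by
  have hu0 : 0 < u := by linarith
  have hlu := hl.pos u hu
  calc _ = ENNReal.ofReal (l u / u ^ β) * ENNReal.ofReal (u ^ e) := by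
        rw [← ENNReal.ofReal_mul (by positivity), Real.rpow_sub hu0]
        congr 1; ring
    _ ≤ c * lamTail lam u * ENNReal.ofReal (u ^ e) := by gcongr; exact hge u hu
    _ = _ := mul_assoc _ _ _

lemma upperTailMean_dominated (hl : IsSlowlyVarying l) (hβ : 0 ≤ β)
    (hle : ∀ r, 1 ≤ r → lamTail lam r ≤ c * ENNReal.ofReal (l r / r ^ β))
    (hge : ∀ r, 1 ≤ r → ENNReal.ofReal (l r / r ^ β) ≤ c * lamTail lam r)
    {q : ℝ} (hqβ : q < β) :
    Dominated (upperTailMean lam q) (fun r => ENNReal.ofReal (l r / r ^ β)) := by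
  -- Half of the gap pays for Potter's bound; the other half leaves the integrable power `u^{-δ-1}`.
  set δ := (β - q) / 2 with hδ
  have hδ0 : 0 < δ := by rw [hδ]; linarith
  obtain ⟨C, hC, r₀, hr₀, hP⟩ := hl.potter hβ (by positivity) (almost_antitone hl hle hge) hδ0
  refine ⟨c * (C / δ).toNNReal, ?_⟩
  filter_upwards [eventually_ge_atTop r₀] with r hr
  have hr1 : 1 ≤ r := hr₀.trans hr
  have hr0 : 0 < r := by linarith
  have hlr := hl.pos r hr1
  have h1 : ∫⁻ u in Ioi r, lamTail lam u * ENNReal.ofReal (u ^ (q - 1)) ≤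
      c * ENNReal.ofReal (C * l r * r ^ (-δ)) * ENNReal.ofReal (r ^ (-δ) / δ) := by
    calc _ ≤ ∫⁻ u in Ioi r, c * ENNReal.ofReal (C * l r * r ^ (-δ)) *
          ENNReal.ofReal (u ^ (-δ - 1)) := by
            refine setLIntegral_mono' measurableSet_Ioi fun u hu => ?_
            have hu1 : r ≤ u := le_of_lt hu
            have hu0 : 0 < u := hr0.trans_le hu1
            refine (lamTail_mul_le hl hle (hr1.trans hu1) _).trans ?_
            rw [mul_assoc, ← ENNReal.ofReal_mul (by positivity)]
            gcongr _ * ENNReal.ofReal ?_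
            calc l u * u ^ (q - 1 - β) ≤ C * (u / r) ^ δ * l r * u ^ (q - 1 - β) := by
                  gcongr; exact (hP r u hr hu1).1
              _ = C * l r * r ^ (-δ) * (u ^ δ * u ^ (q - 1 - β)) := by
                  rw [Real.div_rpow hu0.le hr0.le, Real.rpow_neg hr0.le]; ring
              _ = _ := by
                  rw [← Real.rpow_add hu0]; congr 2; rw [hδ]; ring
      _ = _ := by
        rw [lintegral_const_mul' _ _ (ENNReal.mul_ne_top ENNReal.coe_ne_top ENNReal.ofReal_ne_top),
          lintegral_Ioi_rpow_volume (by linarith) hr0, sub_add_cancel, neg_div_neg_eq]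
  calc upperTailMean lam q r ≤ ENNReal.ofReal (1 / r ^ q) *
        (c * ENNReal.ofReal (C * l r * r ^ (-δ)) * ENNReal.ofReal (r ^ (-δ) / δ)) := by
          rw [upperTailMean]; gcongr
    _ = c * (ENNReal.ofReal (1 / r ^ q) *
        (ENNReal.ofReal (C * l r * r ^ (-δ)) * ENNReal.ofReal (r ^ (-δ) / δ))) := by ring
    _ = _ := by
      rw [ENNReal.coe_mul, mul_assoc (c : ℝ≥0∞), ← ENNReal.ofReal.eq_1, ← ENNReal.ofReal_mul (by positivity),
        ← ENNReal.ofReal_mul (by positivity), ← ENNReal.ofReal_mul (by positivity)]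
      congr 2
      have : r ^ β = r ^ q * (r ^ δ * r ^ δ) := by
        rw [← Real.rpow_add hr0, ← Real.rpow_add hr0]; congr 1; rw [hδ]; ring
      rw [this, Real.rpow_neg hr0.le]
      field_simp

lemma one_div_rpow_dominated (hl : IsSlowlyVarying l) (hβ : 0 ≤ β)
    (hle : ∀ r, 1 ≤ r → lamTail lam r ≤ c * ENNReal.ofReal (l r / r ^ β))
    (hge : ∀ r, 1 ≤ r → ENNReal.ofReal (l r / r ^ β) ≤ c * lamTail lam r)
    {p : ℝ} (hβp : β < p) :
    Dominated (fun r => ENNReal.ofReal (1 / r ^ p)) (fun r => ENNReal.ofReal (l r / r ^ β)) := by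
  set δ := p - β with hδ
  have hδ0 : 0 < δ := by rw [hδ]; linarith
  obtain ⟨C, hC, r₀, hr₀, hP⟩ := hl.potter hβ (by positivity) (almost_antitone hl hle hge) hδ0
  have hr00 : 0 < r₀ := by linarith
  have hl0 := hl.pos r₀ hr₀
  refine ⟨(C / (l r₀ * r₀ ^ δ)).toNNReal, ?_⟩
  filter_upwards [eventually_ge_atTop r₀] with r hr
  have hr0 : 0 < r := by linarith
  have hlr := hl.pos r (hr₀.trans hr)
  rw [← ENNReal.ofReal.eq_1, ← ENNReal.ofReal_mul (by positivity)]
  refine ENNReal.ofReal_le_ofReal ?_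
  have h := (hP r₀ r le_rfl hr).2
  have hrp : r ^ p = r ^ β * r ^ δ := by rw [← Real.rpow_add hr0]; congr 1; rw [hδ]; ring
  rw [Real.div_rpow hr0.le hr00.le] at h
  have h2 : 1 ≤ C / (l r₀ * r₀ ^ δ) * l r * r ^ δ := by
    have h3 : C / (l r₀ * r₀ ^ δ) * l r * r ^ δ = (C * (r ^ δ / r₀ ^ δ) * l r) / l r₀ := by
      field_simp
    rw [h3, one_le_div hl0]
    exact h
  rw [hrp, div_le_iff₀ (by positivity)]
  calc (1 : ℝ) ≤ _ := h2
    _ = _ := by field_simp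

lemma lowerTailMean_dominated (hl : IsSlowlyVarying l) (hβ : 0 ≤ β)
    (hle : ∀ r, 1 ≤ r → lamTail lam r ≤ c * ENNReal.ofReal (l r / r ^ β))
    (hge : ∀ r, 1 ≤ r → ENNReal.ofReal (l r / r ^ β) ≤ c * lamTail lam r)
    {p : ℝ} (hβp : β < p)
    (hfin : ∀ r, 0 < r → ∫⁻ u in Ioc 0 r, lamTail lam u * ENNReal.ofReal (u ^ (p - 1)) < ∞) :
    Dominated (lowerTailMean lam p) (fun r => ENNReal.ofReal (l r / r ^ β)) := by
  set δ := (p - β) / 2 with hδ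
  have hδ0 : 0 < δ := by rw [hδ]; linarith
  obtain ⟨C, hC, r₀, hr₀, hP⟩ := hl.potter hβ (by positivity) (almost_antitone hl hle hge) hδ0
  have hr00 : 0 < r₀ := by linarith
  -- The part over `(0, r₀]` is a finite constant and contributes `r^{-p}`; beyond `r₀` Potter's
  -- bound applies.
  have hfirst : Dominated (fun r => (∫⁻ u in Ioc 0 r₀, lamTail lam u * ENNReal.ofReal (u ^ (p - 1))) *
      ENNReal.ofReal (1 / r ^ p)) (fun r => ENNReal.ofReal (l r / r ^ β)) :=
    (Dominated.const_mul (hfin r₀ hr00).ne).trans (one_div_rpow_dominated hl hβ hle hge hβp)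
  have hsecond : Dominated (fun r => ENNReal.ofReal (1 / r ^ p) *
      ∫⁻ u in Ioc r₀ r, lamTail lam u * ENNReal.ofReal (u ^ (p - 1)))
      (fun r => ENNReal.ofReal (l r / r ^ β)) := by
    refine ⟨c * (C / δ).toNNReal, ?_⟩
    filter_upwards [eventually_ge_atTop r₀] with r hr
    have hr0 : 0 < r := by linarith
    have hlr := hl.pos r (hr₀.trans hr)
    have h1 : ∫⁻ u in Ioc r₀ r, lamTail lam u * ENNReal.ofReal (u ^ (p - 1)) ≤
        c * ENNReal.ofReal (C * l r * r ^ δ) * ENNReal.ofReal (r ^ δ / δ) := by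
      calc _ ≤ ∫⁻ u in Ioc r₀ r, c * ENNReal.ofReal (C * l r * r ^ δ) *
            ENNReal.ofReal (u ^ (δ - 1)) := by
              refine setLIntegral_mono' measurableSet_Ioc fun u hu => ?_
              have hu1 : r₀ ≤ u := hu.1.le
              have hu0 : 0 < u := hr00.trans_le hu1
              refine (lamTail_mul_le hl hle (hr₀.trans hu1) _).trans ?_
              rw [mul_assoc, ← ENNReal.ofReal_mul (by positivity)]
              gcongr _ * ENNReal.ofReal ?_
              calc l u * u ^ (p - 1 - β) ≤ C * (r / u) ^ δ * l r * u ^ (p - 1 - β) := by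
                    gcongr; exact (hP u r hu1 hu.2).2
                _ = C * l r * r ^ δ * (u ^ (-δ) * u ^ (p - 1 - β)) := by
                    rw [Real.div_rpow hr0.le hu0.le, Real.rpow_neg hu0.le]; ring
                _ = _ := by
                    rw [← Real.rpow_add hu0]; congr 2; rw [hδ]; ring
        _ ≤ ∫⁻ u in Ioc 0 r, c * ENNReal.ofReal (C * l r * r ^ δ) *
            ENNReal.ofReal (u ^ (δ - 1)) := lintegral_mono_set (Ioc_subset_Ioc_left hr00.le)
        _ = _ := by
          rw [lintegral_const_mul' _ _ (ENNReal.mul_ne_top ENNReal.coe_ne_top ENNReal.ofReal_ne_top),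
            lintegral_Ioc_zero_rpow (by linarith) hr0.le, sub_add_cancel]
    calc _ ≤ ENNReal.ofReal (1 / r ^ p) *
          (c * ENNReal.ofReal (C * l r * r ^ δ) * ENNReal.ofReal (r ^ δ / δ)) := by gcongr
      _ = c * (ENNReal.ofReal (1 / r ^ p) *
          (ENNReal.ofReal (C * l r * r ^ δ) * ENNReal.ofReal (r ^ δ / δ))) := by ring
      _ = _ := by
        rw [ENNReal.coe_mul, mul_assoc (c : ℝ≥0∞), ← ENNReal.ofReal.eq_1, ← ENNReal.ofReal_mul (by positivity),
          ← ENNReal.ofReal_mul (by positivity), ← ENNReal.ofReal_mul (by positivity)]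
        congr 2
        have : r ^ p = r ^ β * (r ^ δ * r ^ δ) := by
          rw [← Real.rpow_add hr0, ← Real.rpow_add hr0]; congr 1; rw [hδ]; ring
        rw [this]
        field_simp
  refine Dominated.trans (.of_eventually_le ?_) (hfirst.add hsecond)
  filter_upwards [eventually_ge_atTop r₀] with r hr
  rw [lowerTailMean, ← Ioc_union_Ioc_eq_Ioc hr00.le hr]
  calc _ ≤ ENNReal.ofReal (1 / r ^ p) * (_ + _) := by gcongr; exact lintegral_union_le _ _ _
    _ = _ := by rw [mul_add, mul_comm]

/-- On `(r, 2r]` Potter's bound keeps `l` above a constant multiple of `l r`, so this interval alone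
contributes a multiple of `l r`. -/
lemma ofReal_dominated_lintegral_Ioi (hl : IsSlowlyVarying l) (hβ : 0 ≤ β)
    (hle : ∀ r, 1 ≤ r → lamTail lam r ≤ c * ENNReal.ofReal (l r / r ^ β))
    (hge : ∀ r, 1 ≤ r → ENNReal.ofReal (l r / r ^ β) ≤ c * lamTail lam r) :
    Dominated (fun r => ENNReal.ofReal (l r / r ^ β))
      (fun r => ENNReal.ofReal (1 / r ^ β) * ∫⁻ u in Ioi r, ENNReal.ofReal (l u / u)) := by
  obtain ⟨C, hC, r₀, hr₀, hP⟩ := hl.potter hβ (by positivity) (almost_antitone hl hle hge) one_pos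
  refine ⟨(4 * C).toNNReal, ?_⟩
  filter_upwards [eventually_ge_atTop r₀] with r hr
  have hr0 : 0 < r := by linarith
  have hlr := hl.pos r (hr₀.trans hr)
  have h1 : ENNReal.ofReal (l r / (4 * C)) ≤ ∫⁻ u in Ioi r, ENNReal.ofReal (l u / u) := by
    calc _ = ∫⁻ _ in Ioc r (2 * r), ENNReal.ofReal (l r / (4 * C) / r) := by
          rw [setLIntegral_const, Real.volume_Ioc, ← ENNReal.ofReal_mul (by positivity)]
          congr 1
          have : 2 * r - r = r := by ring
          rw [this]; field_simp
      _ ≤ ∫⁻ u in Ioc r (2 * r), ENNReal.ofReal (l u / u) := by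
          refine setLIntegral_mono' measurableSet_Ioc fun u hu => ENNReal.ofReal_le_ofReal ?_
          have hu0 : 0 < u := hr0.trans hu.1
          have hlu := hl.pos u (by linarith [hu.1])
          have h2 := (hP r u hr hu.1.le).2
          rw [Real.rpow_one] at h2
          have h3 : u / r ≤ 2 := (div_le_iff₀ hr0).2 hu.2
          have h4 : l r ≤ C * 2 * l u := h2.trans (by gcongr)
          rw [div_div, div_le_div_iff₀ (by positivity) hu0]
          calc l r * u ≤ (C * 2 * l u) * (2 * r) := by gcongr; exact hu.2
            _ = _ := by ring
      _ ≤ _ := lintegral_mono_set Ioc_subset_Ioi_self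
  calc ENNReal.ofReal (l r / r ^ β) =
        ((4 * C).toNNReal : ℝ≥0∞) *
          (ENNReal.ofReal (1 / r ^ β) * ENNReal.ofReal (l r / (4 * C))) := by
        rw [← ENNReal.ofReal.eq_1, ← ENNReal.ofReal_mul (by positivity),
          ← ENNReal.ofReal_mul (by positivity)]
        congr 1; field_simp
    _ ≤ _ := by gcongr

lemma ofReal_dominated_lintegral_Ioc (hl : IsSlowlyVarying l) (hβ : 0 ≤ β)
    (hle : ∀ r, 1 ≤ r → lamTail lam r ≤ c * ENNReal.ofReal (l r / r ^ β))
    (hge : ∀ r, 1 ≤ r → ENNReal.ofReal (l r / r ^ β) ≤ c * lamTail lam r) :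
    Dominated (fun r => ENNReal.ofReal (l r / r ^ β))
      (fun r => ENNReal.ofReal (1 / r ^ β) * ∫⁻ u in Ioc 1 r, ENNReal.ofReal (l u / u)) := by
  obtain ⟨C, hC, r₀, hr₀, hP⟩ := hl.potter hβ (by positivity) (almost_antitone hl hle hge) one_pos
  refine ⟨(4 * C).toNNReal, ?_⟩
  -- The interval used is `(r/2, r]`, which has to lie beyond `r₀`.
  filter_upwards [eventually_ge_atTop (2 * r₀)] with r hr
  have hr0 : 0 < r := by linarith
  have hlr := hl.pos r (by linarith)
  have h1 : ENNReal.ofReal (l r / (4 * C)) ≤ ∫⁻ u in Ioc 1 r, ENNReal.ofReal (l u / u) := by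
    calc _ = ∫⁻ _ in Ioc (r / 2) r, ENNReal.ofReal (l r / (2 * C) / r) := by
          rw [setLIntegral_const, Real.volume_Ioc, ← ENNReal.ofReal_mul (by positivity)]
          congr 1
          have : r - r / 2 = r / 2 := by ring
          rw [this]; field_simp; norm_num
      _ ≤ ∫⁻ u in Ioc (r / 2) r, ENNReal.ofReal (l u / u) := by
          refine setLIntegral_mono' measurableSet_Ioc fun u hu => ENNReal.ofReal_le_ofReal ?_
          have hur : r / 2 < u := hu.1
          have hu0 : 0 < u := by linarith
          have hlu := hl.pos u (by linarith)
          have h2 := (hP u r (by linarith) hu.2).1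
          rw [Real.rpow_one] at h2
          have h3 : r / u ≤ 2 := (div_le_iff₀ hu0).2 (by linarith)
          have h4 : l r ≤ C * 2 * l u := h2.trans (by gcongr)
          rw [div_div, div_le_div_iff₀ (by positivity) hu0]
          calc l r * u ≤ (C * 2 * l u) * r := by gcongr; exact hu.2
            _ = _ := by ring
      _ ≤ _ := lintegral_mono_set (Ioc_subset_Ioc_left (by linarith))
  calc ENNReal.ofReal (l r / r ^ β) =
        ((4 * C).toNNReal : ℝ≥0∞) *
          (ENNReal.ofReal (1 / r ^ β) * ENNReal.ofReal (l r / (4 * C))) := by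
        rw [← ENNReal.ofReal.eq_1, ← ENNReal.ofReal_mul (by positivity),
          ← ENNReal.ofReal_mul (by positivity)]
        congr 1; field_simp
    _ ≤ _ := by gcongr

lemma mul_rpow_sub_one_sub_self {u β : ℝ} : l u * u ^ (β - 1 - β) = l u / u := by
  have : β - 1 - β = -1 := by ring
  rw [this, Real.rpow_neg_one, div_eq_mul_inv]

lemma upperTailMean_dominated_self (hl : IsSlowlyVarying l)
    (hle : ∀ r, 1 ≤ r → lamTail lam r ≤ c * ENNReal.ofReal (l r / r ^ β)) :
    Dominated (upperTailMean lam β)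
      (fun r => ENNReal.ofReal (1 / r ^ β) * ∫⁻ u in Ioi r, ENNReal.ofReal (l u / u)) := by
  refine ⟨c, ?_⟩
  filter_upwards [eventually_ge_atTop 1] with r hr
  rw [upperTailMean, mul_left_comm, ← lintegral_const_mul' _ _ ENNReal.coe_ne_top]
  gcongr ENNReal.ofReal (1 / r ^ β) * ?_
  refine setLIntegral_mono' measurableSet_Ioi fun u hu => ?_
  rw [← mul_rpow_sub_one_sub_self (β := β)]
  exact lamTail_mul_le hl hle (hr.trans (le_of_lt hu)) _

lemma dominated_upperTailMean_self (hl : IsSlowlyVarying l)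
    (hge : ∀ r, 1 ≤ r → ENNReal.ofReal (l r / r ^ β) ≤ c * lamTail lam r) :
    Dominated (fun r => ENNReal.ofReal (1 / r ^ β) * ∫⁻ u in Ioi r, ENNReal.ofReal (l u / u))
      (upperTailMean lam β) := by
  refine ⟨c, ?_⟩
  filter_upwards [eventually_ge_atTop 1] with r hr
  rw [upperTailMean, mul_left_comm, ← lintegral_const_mul' _ _ ENNReal.coe_ne_top]
  gcongr ENNReal.ofReal (1 / r ^ β) * ?_
  refine setLIntegral_mono' measurableSet_Ioi fun u hu => ?_
  rw [← mul_rpow_sub_one_sub_self (β := β)]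
  exact le_lamTail_mul hl hge (hr.trans (le_of_lt hu)) _

lemma dominated_lowerTailMean_self (hl : IsSlowlyVarying l)
    (hge : ∀ r, 1 ≤ r → ENNReal.ofReal (l r / r ^ β) ≤ c * lamTail lam r) :
    Dominated (fun r => ENNReal.ofReal (1 / r ^ β) * ∫⁻ u in Ioc 1 r, ENNReal.ofReal (l u / u))
      (lowerTailMean lam β) := by
  refine ⟨c, .of_forall fun r => ?_⟩
  rw [lowerTailMean, mul_left_comm, ← lintegral_const_mul' _ _ ENNReal.coe_ne_top]
  gcongr ENNReal.ofReal (1 / r ^ β) * ?_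
  refine le_trans (setLIntegral_mono' measurableSet_Ioc fun u hu => ?_)
    (lintegral_mono_set (Ioc_subset_Ioc_left zero_le_one))
  rw [← mul_rpow_sub_one_sub_self (β := β)]
  exact le_lamTail_mul hl hge hu.1.le _

/-- Almost monotonicity bounds `l` on `(1, 2]` below by a multiple of `l 2`. Positivity lets the
integral of `l u / u` absorb the finite contribution of `(0, 1]` in the next lemma. -/
lemma lintegral_Ioc_slowlyVarying_ne_zero (hl : IsSlowlyVarying l) (hβ : 0 ≤ β)
    (hle : ∀ r, 1 ≤ r → lamTail lam r ≤ c * ENNReal.ofReal (l r / r ^ β))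
    (hge : ∀ r, 1 ≤ r → ENNReal.ofReal (l r / r ^ β) ≤ c * lamTail lam r) :
    ∫⁻ u in Ioc (1 : ℝ) 2, ENNReal.ofReal (l u / u) ≠ 0 := by
  have hl2 := hl.pos 2 one_le_two
  set k := l 2 / 2 ^ β / (c * c + 1) / 2 with hk
  have hk0 : 0 < k := by positivity
  have h1 : ∫⁻ _ in Ioc (1 : ℝ) 2, ENNReal.ofReal k ≤
      ∫⁻ u in Ioc (1 : ℝ) 2, ENNReal.ofReal (l u / u) := by
    refine setLIntegral_mono' measurableSet_Ioc fun u hu => ENNReal.ofReal_le_ofReal ?_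
    have hu0 : 0 < u := one_pos.trans hu.1
    have hlu := hl.pos u hu.1.le
    have h2 := almost_antitone hl hle hge u 2 hu.1.le hu.2
    have h3 : l u / u ^ β ≤ l u := div_le_self hlu.le (Real.one_le_rpow hu.1.le hβ)
    have h4 : l 2 / 2 ^ β / (c * c + 1) ≤ l u := by
      rw [div_le_iff₀ (by positivity), mul_comm]
      exact h2.trans (by gcongr)
    calc k ≤ l u / 2 := by rw [hk]; gcongr
      _ ≤ l u / u := by gcongr; exact hu.2
  rw [setLIntegral_const, Real.volume_Ioc] at h1
  intro h0
  rw [h0] at h1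
  norm_num at h1
  linarith

lemma lowerTailMean_dominated_self (hl : IsSlowlyVarying l) (hβ : 0 ≤ β)
    (hle : ∀ r, 1 ≤ r → lamTail lam r ≤ c * ENNReal.ofReal (l r / r ^ β))
    (hge : ∀ r, 1 ≤ r → ENNReal.ofReal (l r / r ^ β) ≤ c * lamTail lam r)
    (hfin : ∫⁻ u in Ioc 0 1, lamTail lam u * ENNReal.ofReal (u ^ (β - 1)) < ∞) :
    Dominated (lowerTailMean lam β)
      (fun r => ENNReal.ofReal (1 / r ^ β) * ∫⁻ u in Ioc 1 r, ENNReal.ofReal (l u / u)) := by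
  obtain ⟨n, hn⟩ := ENNReal.exists_nat_mul_gt
    (lintegral_Ioc_slowlyVarying_ne_zero hl hβ hle hge) hfin.ne
  refine ⟨n + c, ?_⟩
  filter_upwards [eventually_ge_atTop 2] with r hr
  rw [lowerTailMean, mul_left_comm]
  gcongr ENNReal.ofReal (1 / r ^ β) * ?_
  rw [← Ioc_union_Ioc_eq_Ioc zero_le_one (one_le_two.trans hr), ENNReal.coe_add, add_mul]
  refine (lintegral_union_le _ _ _).trans (add_le_add ?_ ?_)
  · refine hn.le.trans ?_
    rw [ENNReal.coe_natCast]
    gcongr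
  · rw [← lintegral_const_mul' _ _ ENNReal.coe_ne_top]
    refine setLIntegral_mono' measurableSet_Ioc fun u hu => ?_
    rw [← mul_rpow_sub_one_sub_self (β := β)]
    exact lamTail_mul_le hl hle hu.1.le _

end Karamata

end

/-! ### The theorem -/

theorem lemma3p3 (d : ℕ) [NeZero d] (α : ℝ) (hα0 : 0 < α) (hα2 : α < 2) (t : ℝ) (ht : 0 < t)
    (lam : Measure ℝ) (hlam : IsLevyMeasureOnPos lam)
    (hsmall : ∫⁻ z in Ioc (0 : ℝ) 1, ENNReal.ofReal (z ^ (1 + α / d)) ∂lam < ∞)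
    (hbig : ∫⁻ z in Ioi (1 : ℝ), ENNReal.ofReal (z ^ ((d : ℝ) / (d + α))) ∂lam < ∞) :
    (∫⁻ z in Ioi (1 : ℝ), ENNReal.ofReal (z ^ (1 + α / d)) ∂lam < ∞ →
      AsympEquiv (etaTail d α t lam) (fun r =>
        ENNReal.ofReal (α / d) *
          volume (Metric.ball (0 : EuclideanSpace ℝ (Fin d)) 1) *
          ENNReal.ofReal (1 / r ^ (1 + α / d)) *
          ∫⁻ u in Ioi (0 : ℝ), ENNReal.ofReal (u ^ (α / d)) *
            ∫⁻ z in Ioi (u / stableProfile d α 0),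
              ENNReal.ofReal (stableProfileInv d α (u / z) ^ d) ∂lam)) ∧
    (∀ (β : ℝ) (l : ℝ → ℝ), β ∈ Icc ((d : ℝ) / (d + α)) (1 + α / d) → IsSlowlyVarying l →
      Comparable (𝓟 (Ici 1)) (lamTail lam) (fun r => ENNReal.ofReal (l r / r ^ β)) →
      ((d : ℝ) / (d + α) < β → β < 1 + α / d →
        Comparable atTop (etaTail d α t lam) (lamTail lam)) ∧
      (β = (d : ℝ) / (d + α) → ∫⁻ u in Ioi (1 : ℝ), ENNReal.ofReal (l u / u) < ∞ →
        Comparable atTop (etaTail d α t lam) (fun r =>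
          ENNReal.ofReal (1 / r ^ ((d : ℝ) / (d + α))) *
            ∫⁻ u in Ioi r, ENNReal.ofReal (l u / u))) ∧
      (β = 1 + α / d →
        Comparable atTop (etaTail d α t lam) (fun r =>
          ENNReal.ofReal (1 / r ^ (1 + α / d)) *
            ∫⁻ u in Ioc (1 : ℝ) r, ENNReal.ofReal (l u / u)))) := by
  have hd : (0 : ℝ) < d := by exact_mod_cast NeZero.pos d
  have hp : 0 < 1 + α / d := by positivity
  have hq : 0 < (d : ℝ) / (d + α) := by positivity
  have hqp : (d : ℝ) / (d + α) < 1 + α / d := by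
    have := exponent_pos (d := d) hα0; linarith
  refine ⟨fun h => asympEquiv_etaTail hα0 hα2 ht hlam ?_, fun β l hβ hl hcomp => ?_⟩
  · rw [← Ioc_union_Ioi_eq_Ioi (zero_le_one' ℝ), lintegral_union measurableSet_Ioi
      (Ioc_disjoint_Ioi le_rfl)]
    exact (ENNReal.add_lt_top.2 ⟨hsmall, h⟩).ne
  have hβ0 : 0 ≤ β := hq.le.trans hβ.1
  have hfin : ∀ r, 0 < r →
      ∫⁻ u in Ioc 0 r, lamTail lam u * ENNReal.ofReal (u ^ (1 + α / d - 1)) < ∞ :=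
    fun r hr => lintegral_Ioc_lamTail_lt_top hlam hp hsmall hr
  obtain ⟨c, hc1, hc⟩ := hcomp
  rw [eventually_principal] at hc
  have hc0 : (c : ℝ≥0∞) ≠ 0 := by exact_mod_cast (one_pos.trans_le hc1).ne'
  have hle : ∀ r, 1 ≤ r → lamTail lam r ≤ c * ENNReal.ofReal (l r / r ^ β) := fun r hr =>
    (ENNReal.inv_mul_le_iff hc0 ENNReal.coe_ne_top).1 (hc r hr).1
  have hge : ∀ r, 1 ≤ r → ENNReal.ofReal (l r / r ^ β) ≤ c * lamTail lam r :=
    fun r hr => (hc r hr).2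
  have hlam_le := dominated_lamTail hle
  have hle_lam : Dominated (fun r => ENNReal.ofReal (l r / r ^ β)) (lamTail lam) :=
    ⟨c, by filter_upwards [eventually_ge_atTop 1] with r hr using hge r hr⟩
  obtain ⟨hlow, htail, hup⟩ := dominated_etaTail (d := d) hα0 hα2 ht hlam
  refine ⟨fun hβ1 hβ2 => ?_, fun hβq _ => ?_, fun hβp => ?_⟩
  -- Strict inequalities on both sides make both means of the order of `λ̄`. In each boundary case
  -- below, one mean is itself comparable to the claimed function, which also dominates `l r / r^β`
  -- and hence the other two terms.
  · exact (etaTail_dominated hα0 hα2 ht hlam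
      ((lowerTailMean_dominated hl hβ0 hle hge hβ2 hfin).trans hle_lam)
      (Dominated.of_eventually_le (.of_forall fun _ => le_rfl))
      ((upperTailMean_dominated hl hβ0 hle hge hβ1).trans hle_lam)).comparable htail
  · subst hβq
    have hL := ofReal_dominated_lintegral_Ioi hl hβ0 hle hge
    exact (etaTail_dominated hα0 hα2 ht hlam
      ((lowerTailMean_dominated hl hβ0 hle hge hqp hfin).trans hL) (hlam_le.trans hL)
      (upperTailMean_dominated_self hl hle)).comparable
      ((dominated_upperTailMean_self hl hge).trans hup)
  · subst hβp
    have hL := ofReal_dominated_lintegral_Ioc hl hβ0 hle hge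
    exact (etaTail_dominated hα0 hα2 ht hlam
      (lowerTailMean_dominated_self hl hβ0 hle hge (hfin 1 one_pos)) (hlam_le.trans hL)
      ((upperTailMean_dominated hl hβ0 hle hge hqp).trans hL)).comparable
      ((dominated_lowerTailMean_self hl hge).trans hlow)
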